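/- Let $G$ be a locally compact group and let $M$ be a von Neumann algebra with predual $M_*$. Let $\alpha$ be an action of $G$ on $M$, i.e. a homomorphism $x\mapsto\alpha_x$ from $G$ into the group of $*$-automorphisms of $M$ such that for each $m\in M$ the map $x\mapsto\alpha_x(m)$ is weak$^*$-continuous. Put $\beta_x=(\alpha_{x^{-1}})_*:M_*\to M_*$. Assume that (a) $A=M_*$ is a Banach algebra for some product (with its norm as predual of $M$), and (b) each $\beta_x$ ($x\in G$) is an isomorphism of the Banach algebra $A$. Let $S_*(M)\subset A$ be the set of normal states of $M$. A left Banach $G$-$A$-module is a Banach space $X$ that is a left $G$-module with $\|x\xi\|\le\|\xi\|$ and with $x\mapsto x\xi$ norm continuous on $G$ for each $\xi\in X$, that is also a left $A$-module with $\|a\xi\|\le\|a\|\,\|\xi\|$, and for which $\beta_x(a)\xi=x(a(x^{-1}\xi))$ for all $x\in G$, $a\in A$, $\xi\in X$. For $x\in G$ and $a\in A$ let $T_x,T_a\in B(X^{**})$ be the second transposes of the operators $\xi\mapsto x\xi$ and $\xi\mapsto a\xi$ on $X$. Let $P_X$ be the closure of $\{T_a: a\in S_*(M)\}$ in the weak$^*$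 topology of $B(X^{**})=(X^{**}\widehat{\otimes}X^*)^*$. The Banach algebra $A$ has the $G$-fixed point property if for every left Banach $G$-$A$-module $X$ there exists $T_0\in P_X$ such that $T_xT_0T_{x^{-1}}=T_0$ for all $x\in G$. Then $A$ has the $G$-fixed point property if and only if it has that property when $G$ is given the discrete topology (that is, when the continuity requirement on $x\mapsto x\xi$ in the definition of a left Banach $G$-$A$-module is dropped). -/

import Mathlib

universe u v a w

namespace VonNeumannAlgebra

section Normality

open scoped InnerProductSpace ComplexOrder Topology
open Filter

variable {H : Type*} [NormedAddCommGroup H] [InnerProductSpace ℂ H] [CompleteSpace H]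

theorem isClosed_coe (M : VonNeumannAlgebra H) : IsClosed (M : Set (H →L[ℂ] H)) := by
  rw [← M.centralizer_centralizer]
  exact Set.isClosed_centralizer _

theorem exists_sqrt (M : VonNeumannAlgebra H) (a : M.toStarSubalgebra)
    (ha : 0 ≤ (a : H →L[ℂ] H)) : ∃ s : M.toStarSubalgebra, a = star s * s := by
  have : IsClosed (M.toStarSubalgebra : Set (H →L[ℂ] H)) := M.isClosed_coe
  have hs : CFC.sqrt (a : H →L[ℂ] H) ∈ M.toStarSubalgebra := by
    rw [CFC.sqrt_eq_real_sqrt _ ha, cfcₙ_eq_cfc]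
    exact cfc_mem (𝕜 := ℝ) (𝕜' := ℂ) _ a.2
  refine ⟨⟨_, hs⟩, Subtype.ext ?_⟩
  have h1 : star (CFC.sqrt (a : H →L[ℂ] H)) = CFC.sqrt (a : H →L[ℂ] H) :=
    (CFC.sqrt_nonneg (a : H →L[ℂ] H)).isSelfAdjoint
  simp [h1, CFC.sqrt_mul_sqrt_self _ ha]

theorem map_nonneg (M : VonNeumannAlgebra H)
    (σ : M.toStarSubalgebra ≃⋆ₐ[ℂ] M.toStarSubalgebra) (a : M.toStarSubalgebra)
    (ha : 0 ≤ (a : H →L[ℂ] H)) : 0 ≤ (σ a : H →L[ℂ] H) := by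
  obtain ⟨s, rfl⟩ := M.exists_sqrt a ha
  rw [map_mul, map_star]
  exact star_mul_self_nonneg (σ s : H →L[ℂ] H)

theorem nonneg_iff_inner (T : H →L[ℂ] H) : 0 ≤ T ↔ ∀ x, 0 ≤ ⟪x, T x⟫_ℂ := by
  rw [ContinuousLinearMap.nonneg_iff_isPositive, ContinuousLinearMap.isPositive_iff_complex]
  refine forall_congr' fun x => ?_
  have hre : (⟪T x, x⟫_ℂ).re = (⟪x, T x⟫_ℂ).re := by rw [← inner_conj_symm, Complex.conj_re]
  have him : (⟪T x, x⟫_ℂ).im = -(⟪x, T x⟫_ℂ).im := by rw [← inner_conj_symm, Complex.conj_im]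
  rw [Complex.nonneg_iff, Complex.ext_iff]
  simp only [RCLike.re_eq_complex_re, Complex.ofReal_re, Complex.ofReal_im, hre, him]
  constructor
  · rintro ⟨⟨-, h1⟩, h2⟩
    exact ⟨h2, by linarith⟩
  · rintro ⟨h1, h2⟩
    exact ⟨⟨trivial, by linarith⟩, h1⟩

/-- A nonempty chain of operators in `M` between `0` and `1` has a supremum in `M`, and the
supremum is its limit in the sense of quadratic forms. -/
theorem exists_chain_sup (M : VonNeumannAlgebra H) (C : Set (H →L[ℂ] H)) (hne : C.Nonempty)
    (hC : IsChain (· ≤ ·) C) (hM : ∀ h ∈ C, h ∈ M) (h0 : ∀ h ∈ C, 0 ≤ h) (h1 : ∀ h ∈ C, h ≤ 1) :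
    ∃ s ∈ M, (∀ h ∈ C, h ≤ s) ∧ (∀ u : H →L[ℂ] H, (∀ h ∈ C, h ≤ u) → s ≤ u) ∧
      ∀ x : H, ∀ ε > 0, ∃ h ∈ C, (⟪x, s x⟫_ℂ).re < (⟪x, h x⟫_ℂ).re + ε := by
  have : Nonempty C := hne.to_subtype
  have : IsDirected C (· ≤ ·) := ⟨fun a b => by
    rcases hC.total a.2 b.2 with h | h
    · exact ⟨b, h, le_rfl⟩
    · exact ⟨a, le_rfl, h⟩⟩
  let U : Ultrafilter C := Ultrafilter.of atTop
  have hU : (U : Filter C) ≤ atTop := Ultrafilter.of_le atTop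
  have hn : ∀ h ∈ C, ‖h‖ ≤ 1 := fun h hh =>
    (CStarAlgebra.norm_le_one_iff_of_nonneg h (h0 h hh)).2 (h1 h hh)
  have hlim : ∀ x y : H, ∃ l : ℂ, ‖l‖ ≤ ‖x‖ * ‖y‖ ∧
      Tendsto (fun h : C => ⟪(h : H →L[ℂ] H) x, y⟫_ℂ) U (𝓝 l) := by
    intro x y
    have hb : ∀ h : C, ⟪(h : H →L[ℂ] H) x, y⟫_ℂ ∈ Metric.closedBall (0 : ℂ) (‖x‖ * ‖y‖) := by
      intro h
      rw [mem_closedBall_zero_iff]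
      refine (norm_inner_le_norm _ _).trans ?_
      gcongr
      exact ((h : H →L[ℂ] H).le_of_opNorm_le (hn h h.2) x).trans (by simp)
    obtain ⟨l, hl, hl'⟩ := (isCompact_closedBall (0 : ℂ) (‖x‖ * ‖y‖)).ultrafilter_le_nhds
      (U.map fun h : C => ⟪(h : H →L[ℂ] H) x, y⟫_ℂ)
      (le_principal_iff.2 (Filter.mem_map.2 (Filter.univ_mem' hb)))
    exact ⟨l, by simpa using hl, hl'⟩
  choose L hLn hL using hlim
  let B : H →L⋆[ℂ] H →L[ℂ] ℂ := LinearMap.mkContinuous₂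
    (LinearMap.mk₂'ₛₗ (starRingEnd ℂ) (RingHom.id ℂ) L
      (fun x x' y => tendsto_nhds_unique (hL _ _)
        (by simpa [inner_add_left] using (hL x y).add (hL x' y)))
      (fun c x y => tendsto_nhds_unique (hL _ _)
        (by simpa [inner_smul_left, mul_comm] using (hL x y).const_mul (starRingEnd ℂ c)))
      (fun x y y' => tendsto_nhds_unique (hL _ _)
        (by simpa [inner_add_right] using (hL x y).add (hL x y')))
      (fun c x y => tendsto_nhds_unique (hL _ _)
        (by simpa [inner_smul_right] using (hL x y).const_mul c)))
    1 (fun x y => by simpa using hLn x y)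
  let s : H →L[ℂ] H := InnerProductSpace.continuousLinearMapOfBilin B
  have hs : ∀ x y, Tendsto (fun h : C => ⟪(h : H →L[ℂ] H) x, y⟫_ℂ) U (𝓝 ⟪s x, y⟫_ℂ) := by
    intro x y
    have : ⟪s x, y⟫_ℂ = L x y := InnerProductSpace.continuousLinearMapOfBilin_apply B x y
    rw [this]
    exact hL x y
  have hs' : ∀ x, Tendsto (fun h : C => ⟪x, (h : H →L[ℂ] H) x⟫_ℂ) U (𝓝 ⟪x, s x⟫_ℂ) := by
    intro x
    have := (Complex.continuous_conj.tendsto _).comp (hs x x)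
    simpa [Function.comp_def] using this
  refine ⟨s, ?_, ?_, ?_, ?_⟩
  · rw [← SetLike.mem_coe, ← M.centralizer_centralizer, Set.mem_centralizer_iff]
    intro c hc
    ext x
    refine ext_inner_right ℂ fun y => ?_
    have hcomm : ∀ h : C, ∀ z, (h : H →L[ℂ] H) (c z) = c ((h : H →L[ℂ] H) z) := fun h z => by
      have := (Set.mem_centralizer_iff.1 hc) h (hM h h.2)
      exact congrArg (fun T : H →L[ℂ] H => T z) this
    have e1 : ⟪(s * c) x, y⟫_ℂ = ⟪s x, (ContinuousLinearMap.adjoint c) y⟫_ℂ := by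
      refine tendsto_nhds_unique (hs (c x) y) ?_
      simp only [hcomm, ← ContinuousLinearMap.adjoint_inner_right c]
      exact hs x _
    rw [e1, ContinuousLinearMap.adjoint_inner_right]
    rfl
  · intro h hh
    rw [← sub_nonneg, nonneg_iff_inner]
    intro x
    rw [sub_apply, inner_sub_right, sub_nonneg]
    refine ge_of_tendsto (hs' x) (hU ?_)
    filter_upwards [eventually_ge_atTop (⟨h, hh⟩ : C)] with k hk
    have := (nonneg_iff_inner ((k : H →L[ℂ] H) - h)).1 (sub_nonneg.2 hk) x
    rwa [sub_apply, inner_sub_right, sub_nonneg] at this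
  · intro u hu
    rw [← sub_nonneg, nonneg_iff_inner]
    intro x
    rw [sub_apply, inner_sub_right, sub_nonneg]
    refine le_of_tendsto (hs' x) (Filter.Eventually.of_forall fun k => ?_)
    have := (nonneg_iff_inner (u - (k : H →L[ℂ] H))).1 (sub_nonneg.2 (hu k k.2)) x
    rwa [sub_apply, inner_sub_right, sub_nonneg] at this
  · intro x ε hε
    have h2 := (Complex.continuous_re.tendsto _).comp (hs' x)
    obtain ⟨h, hh⟩ := (h2.eventually (lt_mem_nhds (sub_lt_self (⟪x, s x⟫_ℂ).re hε))).exists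
    refine ⟨h, h.2, ?_⟩
    simp only [Function.comp_apply] at hh
    linarith


theorem exists_isLUB (M : VonNeumannAlgebra H) (C : Set M.toStarSubalgebra) (hne : C.Nonempty)
    (hC : IsChain (· ≤ ·) C) (h0 : ∀ h ∈ C, 0 ≤ h) (h1 : ∀ h ∈ C, h ≤ 1) :
    ∃ s : M.toStarSubalgebra, IsLUB C s ∧ ∀ x : H, ∀ ε > 0, ∃ h ∈ C,
      (⟪x, (s : H →L[ℂ] H) x⟫_ℂ).re < (⟪x, (h : H →L[ℂ] H) x⟫_ℂ).re + ε := by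
  obtain ⟨s, hs, h2, h3, h4⟩ := M.exists_chain_sup (Subtype.val '' C) (hne.image _)
    (by
      rintro _ ⟨a, ha, rfl⟩ _ ⟨b, hb, rfl⟩ -
      exact hC.total ha hb)
    (by rintro _ ⟨a, -, rfl⟩; exact a.2)
    (by rintro _ ⟨a, ha, rfl⟩; exact h0 a ha)
    (by rintro _ ⟨a, ha, rfl⟩; exact h1 a ha)
  refine ⟨⟨s, hs⟩, ⟨fun a ha => h2 _ ⟨a, ha, rfl⟩, fun u hu => h3 u ?_⟩, fun x ε hε => ?_⟩
  · rintro _ ⟨a, ha, rfl⟩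
    exact hu ha
  · obtain ⟨_, ⟨a, ha, rfl⟩, h⟩ := h4 x ε hε
    exact ⟨a, ha, h⟩

theorem map_le_map (M : VonNeumannAlgebra H)
    (σ : M.toStarSubalgebra ≃⋆ₐ[ℂ] M.toStarSubalgebra) {a b : M.toStarSubalgebra}
    (h : a ≤ b) : σ a ≤ σ b := by
  have := M.map_nonneg σ (b - a) (sub_nonneg.2 (show (a : H →L[ℂ] H) ≤ b from h))
  rw [map_sub] at this
  exact sub_nonneg.1 (show (0 : H →L[ℂ] H) ≤ (σ b : H →L[ℂ] H) - σ a from this)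

theorem re_inner_mono {S T : H →L[ℂ] H} (h : S ≤ T) (x : H) :
    (⟪x, S x⟫_ℂ).re ≤ (⟪x, T x⟫_ℂ).re := by
  have := (Complex.nonneg_iff.1 ((nonneg_iff_inner (T - S)).1 (sub_nonneg.2 h) x)).1
  rw [sub_apply, inner_sub_right, Complex.sub_re] at this
  linarith

theorem exists_map_isLUB (M : VonNeumannAlgebra H)
    (σ : M.toStarSubalgebra ≃⋆ₐ[ℂ] M.toStarSubalgebra) (C : Set M.toStarSubalgebra)
    (hne : C.Nonempty) (hC : IsChain (· ≤ ·) C) (h0 : ∀ h ∈ C, 0 ≤ h) (h1 : ∀ h ∈ C, h ≤ 1)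
    (s : M.toStarSubalgebra) (hs : IsLUB C s) (x : H) (ε : ℝ) (hε : 0 < ε) : ∃ h ∈ C,
      (⟪x, (σ s : H →L[ℂ] H) x⟫_ℂ).re < (⟪x, (σ h : H →L[ℂ] H) x⟫_ℂ).re + ε := by
  obtain ⟨t, ht, ht'⟩ := M.exists_isLUB (σ '' C) (hne.image _)
    (by
      rintro _ ⟨a, ha, rfl⟩ _ ⟨b, hb, rfl⟩ -
      exact (hC.total ha hb).imp (M.map_le_map σ) (M.map_le_map σ))
    (by rintro _ ⟨a, ha, rfl⟩; exact M.map_nonneg σ a (h0 a ha))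
    (by
      rintro _ ⟨a, ha, rfl⟩
      have := M.map_le_map σ (h1 a ha)
      rwa [map_one] at this)
  have h2 : s ≤ σ.symm t := hs.2 fun a ha => by
    have := M.map_le_map σ.symm (ht.1 ⟨a, ha, rfl⟩)
    rwa [StarAlgEquiv.symm_apply_apply] at this
  have h3 : σ s ≤ t := by
    have := M.map_le_map σ h2
    rwa [StarAlgEquiv.apply_symm_apply] at this
  obtain ⟨_, ⟨a, ha, rfl⟩, h⟩ := ht' x ε hε
  exact ⟨a, ha, (re_inner_mono h3 x).trans_lt h⟩

theorem norm_map_eq (M : VonNeumannAlgebra H)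
    (σ : M.toStarSubalgebra ≃⋆ₐ[ℂ] M.toStarSubalgebra) (a : M.toStarSubalgebra) :
    ‖σ a‖ = ‖a‖ := by
  let _ : CStarAlgebra M.toStarSubalgebra :=
    StarSubalgebra.cstarAlgebra M.toStarSubalgebra (h_closed := M.isClosed_coe)
  exact StarAlgEquiv.norm_map σ a

/-- The functional `m ↦ ⟪η, m ξ⟫` on `M`. -/
noncomputable def vectorFunctional (M : VonNeumannAlgebra H) (ξ η : H) :
    StrongDual ℂ M.toStarSubalgebra :=
  LinearMap.mkContinuous
    { toFun := fun m => ⟪η, (m : H →L[ℂ] H) ξ⟫_ℂ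
      map_add' := fun a b => by simp
      map_smul' := fun c a => by simp }
    (‖η‖ * ‖ξ‖) (fun m => by
      refine (norm_inner_le_norm _ _).trans ?_
      rw [mul_assoc]
      gcongr
      rw [mul_comm]
      exact (m : H →L[ℂ] H).le_opNorm ξ)

theorem vectorFunctional_apply (M : VonNeumannAlgebra H) (ξ η : H) (m : M.toStarSubalgebra) :
    M.vectorFunctional ξ η m = ⟪η, (m : H →L[ℂ] H) ξ⟫_ℂ := rfl

/-- The predual `M_*` of `M`: the norm-closed linear span of the vector functionals in the dual
of `M`, that is, the space of all ultraweakly continuous linear functionals on `M`. -/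
noncomputable def predual (M : VonNeumannAlgebra H) :
    Submodule ℂ (StrongDual ℂ M.toStarSubalgebra) :=
  (Submodule.span ℂ {f | ∃ ξ η : H, f = M.vectorFunctional ξ η}).topologicalClosure

theorem vectorFunctional_mem (M : VonNeumannAlgebra H) (ξ η : H) :
    M.vectorFunctional ξ η ∈ M.predual :=
  Submodule.le_topologicalClosure _ (Submodule.subset_span ⟨ξ, η, rfl⟩)

/-- A `*`-automorphism of `M` as a bounded operator on `M`. -/
noncomputable def autCLM (M : VonNeumannAlgebra H)
    (σ : M.toStarSubalgebra ≃⋆ₐ[ℂ] M.toStarSubalgebra) :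
    M.toStarSubalgebra →L[ℂ] M.toStarSubalgebra :=
  LinearMap.mkContinuous
    ({ toFun := σ, map_add' := fun a b => map_add σ a b, map_smul' := fun c a => map_smul σ c a } :
      M.toStarSubalgebra →ₗ[ℂ] M.toStarSubalgebra) 1
    (fun m => by
      rw [one_mul]
      exact (M.norm_map_eq σ m).le)

theorem autCLM_apply (M : VonNeumannAlgebra H)
    (σ : M.toStarSubalgebra ≃⋆ₐ[ℂ] M.toStarSubalgebra) (m : M.toStarSubalgebra) :
    M.autCLM σ m = σ m := rfl

/-- A functional on `M` that is bounded by `m ↦ ‖m v‖` is a vector functional. -/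
theorem exists_eq_vectorFunctional (M : VonNeumannAlgebra H) (f : StrongDual ℂ M.toStarSubalgebra)
    (v : H) (K : ℝ) (hf : ∀ m : M.toStarSubalgebra, ‖f m‖ ≤ K * ‖(m : H →L[ℂ] H) v‖) :
    ∃ ζ, f = M.vectorFunctional v ζ := by
  let L : M.toStarSubalgebra →ₗ[ℂ] H :=
    { toFun := fun m => (m : H →L[ℂ] H) v
      map_add' := fun a b => by simp
      map_smul' := fun c a => by simp }
  have hker : LinearMap.ker L ≤ LinearMap.ker (f : M.toStarSubalgebra →ₗ[ℂ] ℂ) := by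
    intro m hm
    have h0 : (m : H →L[ℂ] H) v = 0 := hm
    have := hf m
    rw [h0, norm_zero, mul_zero] at this
    exact norm_le_zero_iff.1 this
  let g : LinearMap.range L →ₗ[ℂ] ℂ :=
    ((LinearMap.ker L).liftQ (f : M.toStarSubalgebra →ₗ[ℂ] ℂ) hker).comp
      L.quotKerEquivRange.symm.toLinearMap
  have hg : ∀ m, g ⟨L m, LinearMap.mem_range_self L m⟩ = f m := by
    intro m
    have : L.quotKerEquivRange.symm ⟨L m, LinearMap.mem_range_self L m⟩ =
        (LinearMap.ker L).mkQ m := by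
      rw [LinearEquiv.symm_apply_eq]
      rfl
    simp only [g, LinearMap.comp_apply, LinearEquiv.coe_coe, this]
    rfl
  let g' : StrongDual ℂ (LinearMap.range L) := g.mkContinuous K (by
    rintro ⟨_, m, rfl⟩
    rw [hg m]
    exact hf m)
  obtain ⟨F, hF, -⟩ := exists_extension_norm_eq (LinearMap.range L) g'
  refine ⟨(InnerProductSpace.toDual ℂ H).symm F, ?_⟩
  ext m
  rw [vectorFunctional_apply, InnerProductSpace.toDual_symm_apply]
  exact (hg m).symm.trans (hF ⟨L m, LinearMap.mem_range_self L m⟩).symm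

theorem mul_self_le (b : H →L[ℂ] H) (h0 : 0 ≤ b) (h1 : b ≤ 1) : b * b ≤ b := by
  have hT : IsSelfAdjoint (CFC.sqrt b) := (CFC.sqrt_nonneg b).isSelfAdjoint
  have hb : CFC.sqrt b * CFC.sqrt b = b := CFC.sqrt_mul_sqrt_self b h0
  have h2 := hT.conjugate_nonneg (sub_nonneg.2 h1)
  have h3 : CFC.sqrt b * (1 - b) * CFC.sqrt b = b - b * b := by
    have h4 : CFC.sqrt b * b = b * CFC.sqrt b := by
      calc CFC.sqrt b * b = CFC.sqrt b * (CFC.sqrt b * CFC.sqrt b) := by rw [hb]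
        _ = b * CFC.sqrt b := by rw [← mul_assoc, hb]
    rw [mul_sub, mul_one, sub_mul, hb, h4, mul_assoc, hb]
  rw [h3] at h2
  exact sub_nonneg.1 h2

theorem norm_sq_map (M : VonNeumannAlgebra H)
    (σ : M.toStarSubalgebra ≃⋆ₐ[ℂ] M.toStarSubalgebra) (a : M.toStarSubalgebra) (x : H) :
    ‖(σ a : H →L[ℂ] H) x‖ ^ 2 = (⟪x, (σ (star a * a) : H →L[ℂ] H) x⟫_ℂ).re := by
  rw [map_mul, map_star]
  change _ = (⟪x, (ContinuousLinearMap.adjoint (σ a : H →L[ℂ] H))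
    ((σ a : H →L[ℂ] H) x)⟫_ℂ).re
  rw [ContinuousLinearMap.adjoint_inner_right]
  exact (inner_self_eq_norm_sq (𝕜 := ℂ) _).symm


set_option maxHeartbeats 2000000 in
theorem comp_autCLM_vectorFunctional_mem (M : VonNeumannAlgebra H)
    (σ : M.toStarSubalgebra ≃⋆ₐ[ℂ] M.toStarSubalgebra) (ξ : H) :
    (M.vectorFunctional ξ ξ).comp (M.autCLM σ) ∈ M.predual := by
  -- `pull b` is the functional `m ↦ ⟪ξ, σ (m * b) ξ⟫`
  set p : M.toStarSubalgebra → ℝ := fun k => (⟪ξ, (σ k : H →L[ℂ] H) ξ⟫_ℂ).re with hp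
  set pull : M.toStarSubalgebra → StrongDual ℂ M.toStarSubalgebra := fun b =>
    (M.vectorFunctional ((σ b : H →L[ℂ] H) ξ) ξ).comp (M.autCLM σ) with hpull
  have pull_apply : ∀ b m, pull b m = ⟪ξ, (σ m : H →L[ℂ] H) ((σ b : H →L[ℂ] H) ξ)⟫_ℂ :=
    fun b m => rfl
  have pull_add : ∀ b c, pull (b + c) = pull b + pull c := by
    intro b c
    ext m
    rw [add_apply, pull_apply, pull_apply, pull_apply, map_add]
    simp
  have pull_sub : ∀ b c, pull (b - c) = pull b - pull c := by
    intro b c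
    rw [eq_sub_iff_add_eq, ← pull_add, sub_add_cancel]
  have p_add : ∀ b c, p (b + c) = p b + p c := by
    intro b c
    simp only [hp, map_add]
    simp
  have p_sub : ∀ b c, p (b - c) = p b - p c := by
    intro b c
    rw [eq_sub_iff_add_eq, ← p_add, sub_add_cancel]
  have p_mono : ∀ b c, b ≤ c → p b ≤ p c := fun b c h => re_inner_mono (M.map_le_map σ h) ξ
  have pull_norm : ∀ b m, ‖pull b m‖ ≤ ‖ξ‖ * ‖(σ (m * b) : H →L[ℂ] H) ξ‖ := by
    intro b m
    rw [pull_apply, map_mul]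
    exact norm_inner_le_norm _ _
  have hsq : ∀ b : M.toStarSubalgebra, 0 ≤ b → b ≤ 1 → star b * b ≤ b := by
    intro b h0 h1
    have h2 : star b = b := Subtype.ext (IsSelfAdjoint.of_nonneg
      (show (0 : H →L[ℂ] H) ≤ b from h0)).star_eq
    rw [h2]
    exact mul_self_le (b : H →L[ℂ] H) h0 h1
  have pull_bound : ∀ b : M.toStarSubalgebra, 0 ≤ b → b ≤ 1 →
      ‖pull b‖ ≤ ‖ξ‖ * Real.sqrt (p b) := by
    intro b h0 h1
    refine ContinuousLinearMap.opNorm_le_bound _ (by positivity) fun m => ?_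
    have h2 : ‖(σ b : H →L[ℂ] H) ξ‖ ≤ Real.sqrt (p b) := by
      refine Real.le_sqrt_of_sq_le ?_
      rw [M.norm_sq_map σ b ξ]
      exact p_mono _ _ (hsq b h0 h1)
    rw [pull_apply]
    calc ‖⟪ξ, (σ m : H →L[ℂ] H) ((σ b : H →L[ℂ] H) ξ)⟫_ℂ‖
        ≤ ‖ξ‖ * ‖(σ m : H →L[ℂ] H) ((σ b : H →L[ℂ] H) ξ)‖ := norm_inner_le_norm _ _
      _ ≤ ‖ξ‖ * (‖σ m‖ * ‖(σ b : H →L[ℂ] H) ξ‖) := by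
          gcongr
          exact (σ m : H →L[ℂ] H).le_opNorm _
      _ ≤ ‖ξ‖ * (‖m‖ * Real.sqrt (p b)) := by
          rw [M.norm_map_eq]
          gcongr
      _ = ‖ξ‖ * Real.sqrt (p b) * ‖m‖ := by ring
  have hclosed : IsClosed (M.predual : Set (StrongDual ℂ M.toStarSubalgebra)) :=
    Submodule.isClosed_topologicalClosure _
  -- domination by a vector functional below `q`
  have dom : ∀ (q : M.toStarSubalgebra) (η : H) (c : ℝ), 0 ≤ c → 0 ≤ q → q ≤ 1 →
      (∀ k, 0 ≤ k → k ≤ q → p k ≤ c * (⟪η, (k : H →L[ℂ] H) η⟫_ℂ).re) → pull q ∈ M.predual := by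
    intro q η c hc hq0 hq1 hk
    obtain ⟨ζ, hζ⟩ := M.exists_eq_vectorFunctional (pull q) ((q : H →L[ℂ] H) η)
      (‖ξ‖ * Real.sqrt c) (by
        intro m
        refine (pull_norm q m).trans ?_
        rw [mul_assoc]
        gcongr
        rw [← Real.sqrt_sq (norm_nonneg ((m : H →L[ℂ] H) ((q : H →L[ℂ] H) η))),
          ← Real.sqrt_mul hc]
        refine Real.le_sqrt_of_sq_le ?_
        have hr : (0 : ℝ) < ‖m‖ ^ 2 + 1 := by positivity
        set r : ℝ := ‖m‖ ^ 2 + 1 with hrdef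
        set w : M.toStarSubalgebra := star (m * q) * (m * q) with hw
        have hqs : star q = q := Subtype.ext (IsSelfAdjoint.of_nonneg
          (show (0 : H →L[ℂ] H) ≤ q from hq0)).star_eq
        have hw0 : (0 : H →L[ℂ] H) ≤ w := star_mul_self_nonneg ((m * q : M.toStarSubalgebra) :
          H →L[ℂ] H)
        have inner_w : ∀ x, (⟪x, (w : H →L[ℂ] H) x⟫_ℂ).re =
            ‖(m : H →L[ℂ] H) ((q : H →L[ℂ] H) x)‖ ^ 2 := by
          intro x
          exact (M.norm_sq_map 1 (m * q) x).symm
        have inner_q : ∀ x, ‖(q : H →L[ℂ] H) x‖ ^ 2 ≤ (⟪x, (q : H →L[ℂ] H) x⟫_ℂ).re := by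
          intro x
          have := M.norm_sq_map 1 q x
          refine this.trans_le (re_inner_mono (hsq q hq0 hq1) x)
        set k : M.toStarSubalgebra := ((r⁻¹ : ℝ) : ℂ) • w with hkdef
        have inner_k : ∀ x, ⟪x, (k : H →L[ℂ] H) x⟫_ℂ =
            ((r⁻¹ : ℝ) : ℂ) * ⟪x, (w : H →L[ℂ] H) x⟫_ℂ := by
          intro x
          exact inner_smul_right x _ _
        have hk0 : 0 ≤ k := by
          refine (nonneg_iff_inner (k : H →L[ℂ] H)).2 fun x => ?_
          rw [inner_k]
          refine mul_nonneg ?_ ((nonneg_iff_inner _).1 hw0 x)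
          exact_mod_cast (inv_pos.2 hr).le
        have hkq : k ≤ q := by
          refine sub_nonneg.1 ((nonneg_iff_inner ((q : H →L[ℂ] H) - (k : H →L[ℂ] H))).2 fun x => ?_)
          rw [sub_apply, inner_sub_right, sub_nonneg]
          have i1 := (Complex.nonneg_iff.1 ((nonneg_iff_inner (k : H →L[ℂ] H)).1 hk0 x)).2
          have i2 := (Complex.nonneg_iff.1 ((nonneg_iff_inner (q : H →L[ℂ] H)).1 hq0 x)).2
          refine Complex.le_def.2 ⟨?_, i1.symm.trans i2⟩
          rw [inner_k, Complex.re_ofReal_mul, inner_w, inv_mul_le_iff₀ hr]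
          calc ‖(m : H →L[ℂ] H) ((q : H →L[ℂ] H) x)‖ ^ 2
              ≤ (‖m‖ * ‖(q : H →L[ℂ] H) x‖) ^ 2 := by
                gcongr
                exact (m : H →L[ℂ] H).le_opNorm _
            _ = ‖m‖ ^ 2 * ‖(q : H →L[ℂ] H) x‖ ^ 2 := by ring
            _ ≤ r * (⟪x, (q : H →L[ℂ] H) x⟫_ℂ).re := by
                gcongr
                · linarith
                · exact inner_q x
        have hfin := hk k hk0 hkq
        rw [inner_k, Complex.re_ofReal_mul, inner_w] at hfin
        have hpk : p k = r⁻¹ * p w := by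
          simp only [hp, hkdef, map_smul]
          change (⟪ξ, ((r⁻¹ : ℝ) : ℂ) • (σ w : H →L[ℂ] H) ξ⟫_ℂ).re = _
          rw [inner_smul_right, Complex.re_ofReal_mul]
        rw [hpk] at hfin
        rw [M.norm_sq_map σ (m * q) ξ]
        have h5 : r⁻¹ * p w ≤ r⁻¹ * (c * ‖(m : H →L[ℂ] H) ((q : H →L[ℂ] H) η)‖ ^ 2) := by
          linarith
        exact le_of_mul_le_mul_left h5 (inv_pos.2 hr))
    rw [hζ]
    exact M.vectorFunctional_mem _ _
  -- a maximal `h` between `0` and `1` with `pull h ∈ M.predual`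
  obtain ⟨h, ⟨hh0, hh1, hhmem⟩, hmax⟩ := zorn_le₀
    {h : M.toStarSubalgebra | 0 ≤ h ∧ h ≤ 1 ∧ pull h ∈ M.predual} (by
      intro C hCs hC
      rcases C.eq_empty_or_nonempty with rfl | hne
      · refine ⟨0, ⟨le_rfl, (zero_le_one : (0 : H →L[ℂ] H) ≤ 1), ?_⟩, by simp⟩
        have : pull 0 = 0 := by simpa using pull_sub 0 0
        rw [this]
        exact zero_mem _
      · obtain ⟨s, hs, -⟩ := M.exists_isLUB C hne hC (fun a ha => (hCs ha).1)
          (fun a ha => (hCs ha).2.1)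
        obtain ⟨a₀, ha₀⟩ := hne
        refine ⟨s, ⟨(hCs ha₀).1.trans (hs.1 ha₀), hs.2 fun a ha => (hCs ha).2.1, ?_⟩,
          fun z hz => hs.1 hz⟩
        rw [← SetLike.mem_coe, ← hclosed.closure_eq, Metric.mem_closure_iff]
        intro ε hε
        have hδ : 0 < (ε / (‖ξ‖ + 1)) ^ 2 := by positivity
        obtain ⟨a, ha, hlt⟩ := M.exists_map_isLUB σ C ⟨a₀, ha₀⟩ hC (fun a ha => (hCs ha).1)
          (fun a ha => (hCs ha).2.1) s hs ξ _ hδ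
        refine ⟨pull a, (hCs ha).2.2, ?_⟩
        rw [dist_eq_norm, ← pull_sub]
        have hsa : (0 : M.toStarSubalgebra) ≤ s - a :=
          sub_nonneg.2 (show (a : H →L[ℂ] H) ≤ s from hs.1 ha)
        have hsa1 : s - a ≤ 1 := by
          have t1 : (s : H →L[ℂ] H) - a ≤ s :=
            sub_le_self _ (show (0 : H →L[ℂ] H) ≤ a from (hCs ha).1)
          exact t1.trans (hs.2 fun a ha => (hCs ha).2.1 : s ≤ 1)
        have hlt' : p (s - a) < (ε / (‖ξ‖ + 1)) ^ 2 := by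
          rw [p_sub]
          simp only [hp]
          linarith
        calc ‖pull (s - a)‖ ≤ ‖ξ‖ * Real.sqrt (p (s - a)) := pull_bound _ hsa hsa1
          _ ≤ ‖ξ‖ * (ε / (‖ξ‖ + 1)) := by
              gcongr
              exact Real.sqrt_le_iff.2 ⟨by positivity, hlt'.le⟩
          _ < ε := by
              rw [mul_div_assoc', div_lt_iff₀ (by positivity)]
              nlinarith [norm_nonneg ξ])
  have hone : h = 1 := by
    by_contra hne1
    set P : M.toStarSubalgebra := 1 - h with hP
    have hP0 : (0 : H →L[ℂ] H) ≤ P := sub_nonneg.2 (show (h : H →L[ℂ] H) ≤ 1 from hh1)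
    have hP1 : (P : H →L[ℂ] H) ≤ 1 := sub_le_self _ (show (0 : H →L[ℂ] H) ≤ h from hh0)
    -- a vector at which `P` does not vanish
    obtain ⟨η, hη⟩ : ∃ η, 0 < (⟪η, (P : H →L[ℂ] H) η⟫_ℂ).re := by
      by_contra hcon
      push Not at hcon
      have hle : (P : H →L[ℂ] H) ≤ 0 := by
        refine sub_nonneg.1 ((nonneg_iff_inner (0 - (P : H →L[ℂ] H))).2 fun x => ?_)
        rw [sub_apply, inner_sub_right, sub_nonneg]
        have i1 := (Complex.nonneg_iff.1 ((nonneg_iff_inner (P : H →L[ℂ] H)).1 hP0 x)).2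
        exact Complex.le_def.2 ⟨by simpa using hcon x, by simpa using i1.symm⟩
      have hz : P = 0 := Subtype.ext (le_antisymm hle hP0)
      exact hne1 (sub_eq_zero.1 hz).symm
    set g : M.toStarSubalgebra → ℝ := fun k => (⟪η, (k : H →L[ℂ] H) η⟫_ℂ).re with hg
    have g_add : ∀ b c, g (b + c) = g b + g c := by
      intro b c
      simp [hg]
    obtain ⟨c, hc0, hc⟩ : ∃ c : ℝ, 0 ≤ c ∧ p P < c * g P := by
      refine ⟨(|p P| + 1) / g P, div_nonneg (by positivity) hη.le, ?_⟩
      rw [div_mul_cancel₀ _ hη.ne']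
      linarith [le_abs_self (p P)]
    obtain ⟨k, ⟨hk0, hkP, hkp⟩, hkmax⟩ := zorn_le₀
      {k : M.toStarSubalgebra | 0 ≤ k ∧ k ≤ P ∧ c * g k ≤ p k} (by
        intro C hCs hC
        rcases C.eq_empty_or_nonempty with rfl | hne
        · exact ⟨0, ⟨le_rfl, hP0, by simp [hg, hp]⟩, by simp⟩
        · obtain ⟨s, hs, hs'⟩ := M.exists_isLUB C hne hC (fun a ha => (hCs ha).1)
            (fun a ha => (hCs ha).2.1.trans hP1)
          obtain ⟨a₀, ha₀⟩ := hne
          refine ⟨s, ⟨(hCs ha₀).1.trans (hs.1 ha₀), hs.2 fun a ha => (hCs ha).2.1, ?_⟩,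
            fun z hz => hs.1 hz⟩
          refine le_of_forall_pos_le_add fun ε hε => ?_
          obtain ⟨a, ha, hlt⟩ := hs' η (ε / (c + 1)) (by positivity)
          calc c * g s ≤ c * (g a + ε / (c + 1)) := by gcongr
            _ = c * g a + c * (ε / (c + 1)) := by ring
            _ ≤ p s + ε := by
                refine add_le_add ((hCs ha).2.2.trans (p_mono _ _ (hs.1 ha))) ?_
                rw [mul_div_assoc', div_le_iff₀ (by positivity)]
                nlinarith)
    set q : M.toStarSubalgebra := P - k with hq
    have hq0 : (0 : H →L[ℂ] H) ≤ q := sub_nonneg.2 (show (k : H →L[ℂ] H) ≤ P from hkP)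
    have hqP : (q : H →L[ℂ] H) ≤ P := sub_le_self _ (show (0 : H →L[ℂ] H) ≤ k from hk0)
    have hqmem : pull q ∈ M.predual := by
      refine dom q η c hc0 hq0 (hqP.trans hP1) fun l hl0 hlq => ?_
      by_contra hcon
      push Not at hcon
      have hlk : k + l ∈ {k : M.toStarSubalgebra | 0 ≤ k ∧ k ≤ P ∧ c * g k ≤ p k} := by
        refine ⟨add_nonneg (show (0 : H →L[ℂ] H) ≤ k from hk0)
          (show (0 : H →L[ℂ] H) ≤ l from hl0), ?_, ?_⟩
        · have : (k : H →L[ℂ] H) + l ≤ k + q := add_le_add le_rfl (show (l : H →L[ℂ] H) ≤ q from hlq)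
          have e : (k : H →L[ℂ] H) + q = P := by simp [hq]
          exact this.trans_eq e
        · rw [g_add, p_add, mul_add]
          exact add_le_add hkp hcon.le
      have hle : (k : H →L[ℂ] H) + l ≤ k :=
        hkmax hlk (show (k : H →L[ℂ] H) ≤ k + l from
          le_add_of_nonneg_right (show (0 : H →L[ℂ] H) ≤ l from hl0))
      have hl : l = 0 := Subtype.ext (le_antisymm
        ((add_le_iff_nonpos_right (k : H →L[ℂ] H)).1 hle) hl0)
      rw [hl] at hcon
      simp [hp] at hcon
    have hmem : h + q ∈ {h : M.toStarSubalgebra | 0 ≤ h ∧ h ≤ 1 ∧ pull h ∈ M.predual} := by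
      refine ⟨add_nonneg (show (0 : H →L[ℂ] H) ≤ h from hh0) hq0, ?_, ?_⟩
      · have : (h : H →L[ℂ] H) + q ≤ h + P := add_le_add le_rfl hqP
        have e : (h : H →L[ℂ] H) + P = 1 := by simp [hP]
        exact this.trans_eq e
      · rw [pull_add]
        exact add_mem hhmem hqmem
    have hle : (h : H →L[ℂ] H) + q ≤ h :=
      hmax hmem (show (h : H →L[ℂ] H) ≤ h + q from le_add_of_nonneg_right hq0)
    have hqz : q = 0 := Subtype.ext (le_antisymm
      ((add_le_iff_nonpos_right (h : H →L[ℂ] H)).1 hle) hq0)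
    have hPk : P = k := sub_eq_zero.1 hqz
    rw [← hPk] at hkp
    linarith
  have h1 : pull 1 = (M.vectorFunctional ξ ξ).comp (M.autCLM σ) := by
    ext m
    rw [pull_apply, map_one]
    rfl
  rw [← h1, ← hone]
  exact hhmem

/-- Automatic normality: `φ ∘ σ ∈ M_*` for `φ ∈ M_*` and every `*`-automorphism `σ` of `M`. -/
theorem comp_autCLM_mem_predual (M : VonNeumannAlgebra H)
    (σ : M.toStarSubalgebra ≃⋆ₐ[ℂ] M.toStarSubalgebra) (φ : StrongDual ℂ M.toStarSubalgebra)
    (hφ : φ ∈ M.predual) : φ.comp (M.autCLM σ) ∈ M.predual := by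
  let R : StrongDual ℂ M.toStarSubalgebra →L[ℂ] StrongDual ℂ M.toStarSubalgebra :=
    ContinuousLinearMap.precomp ℂ (M.autCLM σ)
  have hle : M.predual ≤ M.predual.comap R.toLinearMap := by
    refine Submodule.topologicalClosure_minimal _ (Submodule.span_le.2 ?_)
      ((Submodule.isClosed_topologicalClosure _).preimage R.continuous)
    rintro _ ⟨ξ, η, rfl⟩
    have key : ∀ v, R (M.vectorFunctional v v) ∈ M.predual :=
      fun v => M.comp_autCLM_vectorFunctional_mem σ v
    have pol : M.vectorFunctional ξ η = (4 : ℂ)⁻¹ •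
        (M.vectorFunctional (ξ + η) (ξ + η) - M.vectorFunctional (ξ - η) (ξ - η)
          + Complex.I • M.vectorFunctional (ξ + Complex.I • η) (ξ + Complex.I • η)
          - Complex.I • M.vectorFunctional (ξ - Complex.I • η) (ξ - Complex.I • η)) := by
      ext m
      simp only [vectorFunctional_apply, smul_apply, sub_apply, add_apply, map_add, map_sub,
        map_smul, inner_add_left, inner_add_right, inner_sub_left, inner_sub_right,
        inner_smul_left, inner_smul_right, smul_eq_mul, Complex.conj_I]
      ring_nf
      simp only [Complex.I_sq]
      ring
    change R (M.vectorFunctional ξ η) ∈ M.predual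
    rw [pol, map_smul, map_sub, map_add, map_sub, map_smul, map_smul]
    exact Submodule.smul_mem _ _ (sub_mem (add_mem (sub_mem (key _) (key _))
      (Submodule.smul_mem _ _ (key _))) (Submodule.smul_mem _ _ (key _)))
  exact hle hφ

end Normality

section Predual

open scoped ComplexOrder

variable {H : Type u} [NormedAddCommGroup H] [InnerProductSpace ℂ H] [CompleteSpace H]

/-- The preadjoint `σ_* : M_* → M_*` of a `*`-automorphism `σ` of `M`: `σ_* φ = φ ∘ σ`. -/
noncomputable def predualMap (M : VonNeumannAlgebra H)
    (σ : M.toStarSubalgebra ≃⋆ₐ[ℂ] M.toStarSubalgebra) : M.predual →ₗ[ℂ] M.predual where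
  toFun φ := ⟨(φ : StrongDual ℂ M.toStarSubalgebra).comp (M.autCLM σ),
    M.comp_autCLM_mem_predual σ φ φ.2⟩
  map_add' _ _ := rfl
  map_smul' _ _ := rfl

/-- A state of `M`: a positive linear functional with value `1` at the identity. -/
def IsState (M : VonNeumannAlgebra H) (φ : StrongDual ℂ M.toStarSubalgebra) : Prop :=
  φ 1 = 1 ∧ ∀ m : M.toStarSubalgebra, 0 ≤ φ (star m * m)

/-- Continuity requirement in the definition of an action `x ↦ α_x` of a topological group `G` on
`M`: for each `m`, the map `x ↦ α_x(m)` is continuous from `G` to `M` with the weak-star topology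
that `M` carries as the dual of `M_*`. -/
def IsWeakStarContinuous {G : Type v} [Group G] [TopologicalSpace G] (M : VonNeumannAlgebra H)
    (α : G →* (M.toStarSubalgebra ≃⋆ₐ[ℂ] M.toStarSubalgebra)) : Prop :=
  ∀ (m : M.toStarSubalgebra) (φ : M.predual),
    Continuous fun x : G => (φ : StrongDual ℂ M.toStarSubalgebra) (α x m)

variable (M : VonNeumannAlgebra H) {A : Type a} [NonUnitalNormedRing A] [NormedSpace ℂ A]

/-- The set `S_*(M)` of normal states of `M`, as a subset of the Banach algebra `A` whose
underlying Banach space is identified with `M_*` by `ι`. -/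
def normalStates (ι : A ≃ₗᵢ[ℂ] M.predual) : Set A :=
  {b | M.IsState (ι b : StrongDual ℂ M.toStarSubalgebra)}

/-- The maps `β_x = (α_{x⁻¹})_*` on `A = M_*` induced by an action `α` of `G` on `M`. -/
noncomputable def inducedAction {G : Type v} [Group G] (ι : A ≃ₗᵢ[ℂ] M.predual)
    (α : G →* (M.toStarSubalgebra ≃⋆ₐ[ℂ] M.toStarSubalgebra)) (x : G) (b : A) : A :=
  ι.symm (M.predualMap (α x⁻¹) (ι b))

end Predual

end VonNeumannAlgebra

/-- A left Banach `G-A`-module structure on the Banach space `X`, where `G` carries the topology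
`τ` and acts on the Banach algebra `A` by `β`: a left Banach `G`-module structure (contractive,
with norm continuous orbit maps) and a left Banach `A`-module structure, with
`β_x(a) ξ = x a x⁻¹ ξ`. -/
structure BanachGAModule {G : Type v} [Group G] (τ : TopologicalSpace G)
    {A : Type a} [NonUnitalNormedRing A] [NormedSpace ℂ A] (β : G → A → A)
    (X : Type w) [NormedAddCommGroup X] [NormedSpace ℂ X] where
  /-- the operators `ξ ↦ x ξ` for `x` in `G` -/
  actG : G →* (X →L[ℂ] X)
  norm_actG_le : ∀ (x : G) (ξ : X), ‖actG x ξ‖ ≤ ‖ξ‖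
  continuous_actG : ∀ ξ : X, @Continuous G X τ inferInstance fun x => actG x ξ
  /-- the operators `ξ ↦ a ξ` for `a` in `A` -/
  actA : A →ₙₐ[ℂ] (X →L[ℂ] X)
  norm_actA_le : ∀ (b : A) (ξ : X), ‖actA b ξ‖ ≤ ‖b‖ * ‖ξ‖
  covariant : ∀ (x : G) (b : A) (ξ : X), actA (β x b) ξ = actG x (actA b (actG x⁻¹ ξ))

/-- The second dual `X**` of a Banach space `X`. -/
abbrev Bidual (X : Type w) [NormedAddCommGroup X] [NormedSpace ℂ X] : Type w :=
  StrongDual ℂ (StrongDual ℂ X)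

/-- The second transpose `S** : X** → X**` of a bounded operator `S` on `X`:
`(S** n)(f) = n (f ∘ S)`. -/
noncomputable def bidualMap {X : Type w} [NormedAddCommGroup X] [NormedSpace ℂ X]
    (S : X →L[ℂ] X) : Bidual X →L[ℂ] Bidual X :=
  ContinuousLinearMap.precomp ℂ (ContinuousLinearMap.precomp ℂ S)

/-- The weak-star topology on `B(X**)` as the dual of the projective tensor product of `X**` and
`X*`, where `T` is the functional `m ⊗ f ↦ (T m)(f)`. The elements of the projective tensor
product are the sums `∑ i, m i ⊗ f i` with `∑ i, ‖m i‖ * ‖f i‖ < ∞`; the topology is the coarsest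
one making the evaluation of `T` at each of them continuous. -/
@[reducible] noncomputable def bidualWeakStarTopology (X : Type w) [NormedAddCommGroup X] [NormedSpace ℂ X] :
    TopologicalSpace (Bidual X →L[ℂ] Bidual X) :=
  TopologicalSpace.induced
    (fun T (u : {u : ℕ → Bidual X × StrongDual ℂ X //
      Summable fun i => ‖(u i).1‖ * ‖(u i).2‖}) => ∑' i, T (u.1 i).1 (u.1 i).2)
    Pi.topologicalSpace

namespace BanachGAModule

variable {G : Type v} [Group G] {τ : TopologicalSpace G}
  {A : Type a} [NonUnitalNormedRing A] [NormedSpace ℂ A] {β : G → A → A}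
  {X : Type w} [NormedAddCommGroup X] [NormedSpace ℂ X]

/-- The operator `T_x` on `X**`: `(T_x n)(f) = n (f x)` with `(f x)(ξ) = f (x ξ)`. -/
noncomputable def opG (E : BanachGAModule τ β X) (x : G) : Bidual X →L[ℂ] Bidual X :=
  bidualMap (E.actG x)

/-- The operator `T_a` on `X**`: `(T_a n)(f) = n (f a)` with `(f a)(ξ) = f (a ξ)`. -/
noncomputable def opA (E : BanachGAModule τ β X) (b : A) : Bidual X →L[ℂ] Bidual X :=
  bidualMap (E.actA b)

/-- The set `P_X`: the weak-star closure in `B(X**)` of the operators `T_a`, `a` in `S`. -/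
def closureOps (E : BanachGAModule τ β X) (S : Set A) : Set (Bidual X →L[ℂ] Bidual X) :=
  @closure _ (bidualWeakStarTopology X) (E.opA '' S)

/-- `X` has a `G-A`-fixed point: some `T₀` in `P_X` satisfies `T_x T₀ T_{x⁻¹} = T₀` for all `x`. -/
def HasFixedPoint (E : BanachGAModule τ β X) (S : Set A) : Prop :=
  ∃ T₀ ∈ E.closureOps S, ∀ x : G, (E.opG x).comp (T₀.comp (E.opG x⁻¹)) = T₀

end BanachGAModule

/-- The `G`-fixed point property of the Banach algebra `A = M_*` when `G` carries the topology `τ`: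
every left Banach `G-A`-module has a `G-A`-fixed point. -/
def VonNeumannAlgebra.HasFixedPointProperty {G : Type v} [Group G] {H : Type u}
    [NormedAddCommGroup H] [InnerProductSpace ℂ H] [CompleteSpace H] (M : VonNeumannAlgebra H)
    {A : Type a} [NonUnitalNormedRing A] [NormedSpace ℂ A] (ι : A ≃ₗᵢ[ℂ] M.predual)
    (α : G →* (M.toStarSubalgebra ≃⋆ₐ[ℂ] M.toStarSubalgebra)) (τ : TopologicalSpace G) : Prop :=
  ∀ (X : Type (max a w)) [NormedAddCommGroup X] [NormedSpace ℂ X] [CompleteSpace X]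
    (E : BanachGAModule τ (M.inducedAction ι α) X), E.HasFixedPoint (M.normalStates ι)

/-! The fixed point property for either topology on `G` is tied to one condition on `A` that makes
no reference to a topology on `G`: there is a functional `m` on `A* = M` that is a weak-star limit
of normal states and satisfies `m (h ∘ β_x) = m h` for all `x` and `h`.

Such a mean gives a fixed point in every module, continuous or not: put `(T₀ n)(f) = m (b ↦ (T_b
n)(f))` (`averageOp`). Weak-star approximation of `m` by states puts `T₀` in `P_X`, and covariance
turns conjugation by `T_x` into composition with `β_x` inside `m`
(`hasFixedPoint_of_invariant_mean`).

Conversely, `m` is read off from a fixed point of a single module, the unitization `A ⊕ ℂ`: its unit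
`e` is fixed by `G` and `b e = b`, so evaluating `T₀` at `e` and restricting to functionals on `A`
gives `m` (`exists_invariant_mean_of_unitization`).

For the given topology this requires the unitization to be an admissible module, that is, `x ↦
β_x(b)` to be norm continuous. Weak-star continuity of `α` and the duality `(M_*)* = M`
(`exists_eval_eq`) give only weak continuity. On a locally compact group, weak continuity of an
isometric action implies norm continuity (`continuous_orbit_of_weakly_continuous`): a Cantor scheme
of closed sets produces an open set of small norm oscillation, which translations carry to any
point. -/

/-! ### From weakly continuous to norm continuous isometric actions. -/

section WeakContinuity

open Filter Topology

/-- A cluster point of a sequence is mapped by a weakly continuous map into the closed linear span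
of the values of the map along the sequence. -/
theorem MapClusterPt.apply_mem_of_weakly_continuous {Y E : Type*} [TopologicalSpace Y]
    [NormedAddCommGroup E] [NormedSpace ℂ E] {f : Y → E}
    (hf : ∀ h : StrongDual ℂ E, Continuous fun y => h (f y)) (p : Submodule ℂ E)
    (hp : IsClosed (p : Set E)) {u : ℕ → Y} (hu : ∀ n, f (u n) ∈ p) {y : Y}
    (hy : MapClusterPt y atTop u) : f y ∈ p := by
  by_contra hn
  have : IsClosed (p : Set E) := hp
  -- Hahn–Banach in the quotient by `p`, which is a normed space because `p` is closed: a functional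
  -- vanishing on `p` but not at `f y`.
  have h0 : ‖p.mkQL (f y)‖ ≠ 0 := by
    rw [norm_ne_zero_iff]
    intro h
    exact hn ((Submodule.Quotient.mk_eq_zero p).1 h)
  obtain ⟨g, -, hg⟩ := exists_dual_vector ℂ (p.mkQL (f y)) h0
  have hc : IsClosed {z : Y | (g.comp p.mkQL) (f z) = 0} :=
    isClosed_eq (hf (g.comp p.mkQL)) continuous_const
  have hmem : y ∈ {z : Y | (g.comp p.mkQL) (f z) = 0} := by
    refine hc.mem_of_mapClusterPt hy (Eventually.of_forall fun n => ?_)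
    have h1 : p.mkQL (f (u n)) = 0 := (Submodule.Quotient.mk_eq_zero p).2 (hu n)
    change g (p.mkQL (f (u n))) = 0
    rw [h1, map_zero]
  have : g (p.mkQL (f y)) = 0 := hmem
  rw [hg] at this
  exact h0 (Complex.ofReal_eq_zero.1 this)

/-- Two values of a weakly continuous map at distance more than `ε` stay at distance more than `ε`
near the two points. -/
theorem exists_open_separated_of_weakly_continuous {Y E : Type*} [TopologicalSpace Y]
    [NormedAddCommGroup E] [NormedSpace ℂ E] {f : Y → E}
    (hf : ∀ h : StrongDual ℂ E, Continuous fun y => h (f y)) {ε : ℝ} {x y : Y}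
    (hxy : ε < ‖f x - f y‖) : ∃ U ∈ 𝓝 x, ∃ V ∈ 𝓝 y, ∀ x' ∈ U, ∀ y' ∈ V, ε < ‖f x' - f y'‖ := by
  obtain ⟨h, hn, hh⟩ := exists_dual_vector'' ℂ (f x - f y)
  -- A norming functional of `f x - f y` turns the separation into an open condition on a continuous
  -- scalar function; since `‖h‖ ≤ 1`, it bounds the norm from below.
  have hcont : Continuous fun z : Y × Y => ‖h (f z.1) - h (f z.2)‖ :=
    (((hf h).comp continuous_fst).sub ((hf h).comp continuous_snd)).norm
  have hlt : ε < ‖h (f (x, y).1) - h (f (x, y).2)‖ := by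
    simp only [← map_sub, hh]
    simpa using hxy
  have hev := hcont.continuousAt.eventually (lt_mem_nhds hlt)
  rw [nhds_prod_eq] at hev
  obtain ⟨U, hU, V, hV, hUV⟩ := Filter.mem_prod_iff.1 hev
  refine ⟨U, hU, V, hV, fun x' hx' y' hy' => ?_⟩
  have h1 : ε < ‖h (f x') - h (f y')‖ := hUV (Set.mk_mem_prod hx' hy')
  rw [← map_sub] at h1
  refine h1.trans_le ((h.le_of_opNorm_le hn _).trans (by simp))

/-- Branching step of the Cantor scheme. Separation persists on neighbourhoods of the two points,
and regularity shrinks these to closed ones inside `C`. -/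
theorem exists_split_of_oscillation {Y E : Type*} [TopologicalSpace Y] [RegularSpace Y]
    [NormedAddCommGroup E] [NormedSpace ℂ E] {f : Y → E}
    (hf : ∀ h : StrongDual ℂ E, Continuous fun y => h (f y)) {ε : ℝ} {C : Set Y}
    (hosc : ∃ x ∈ interior C, ∃ y ∈ interior C, ε < ‖f x - f y‖) :
    ∃ D : Bool → Set Y, (∀ b, IsClosed (D b) ∧ (interior (D b)).Nonempty ∧ D b ⊆ C) ∧
      ∀ x ∈ D false, ∀ y ∈ D true, ε < ‖f x - f y‖ := by
  obtain ⟨x, hx, y, hy, hxy⟩ := hosc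
  obtain ⟨U, hU, V, hV, hUV⟩ := exists_open_separated_of_weakly_continuous hf hxy
  obtain ⟨K, hK, hKc, hKU⟩ :=
    exists_mem_nhds_isClosed_subset (inter_mem hU (mem_interior_iff_mem_nhds.1 hx))
  obtain ⟨L, hL, hLc, hLV⟩ :=
    exists_mem_nhds_isClosed_subset (inter_mem hV (mem_interior_iff_mem_nhds.1 hy))
  refine ⟨fun b => bif b then L else K, ?_, fun x' hx' y' hy' => hUV _ (hKU hx').1 _ (hLV hy').1⟩
  rintro (_ | _)
  · exact ⟨hKc, ⟨x, mem_interior_iff_mem_nhds.2 hK⟩, fun z hz => (hKU hz).2⟩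
  · exact ⟨hLc, ⟨y, mem_interior_iff_mem_nhds.2 hL⟩, fun z hz => (hLV hz).2⟩

/-- The first `n` terms of a binary sequence, the last one first. -/
def binaryPrefix (σ : ℕ → Bool) : ℕ → List Bool
  | 0 => []
  | n + 1 => σ n :: binaryPrefix σ n

/-- At the first index of disagreement, two branches leave a common node for different children. -/
theorem exists_binaryPrefix_split {σ τ : ℕ → Bool} (h : σ ≠ τ) :
    ∃ n, binaryPrefix σ n = binaryPrefix τ n ∧ σ n ≠ τ n := by
  classical
  have hex : ∃ n, σ n ≠ τ n := Function.ne_iff.1 h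
  refine ⟨Nat.find hex, ?_, Nat.find_spec hex⟩
  have key : ∀ m, (∀ k < m, σ k = τ k) → binaryPrefix σ m = binaryPrefix τ m := by
    intro m
    induction m with
    | zero => intro _; rfl
    | succ m ih =>
      intro hm
      rw [binaryPrefix, binaryPrefix, hm m (Nat.lt_succ_self m),
        ih fun k hk => hm k (hk.trans (Nat.lt_succ_self m))]
  exact key _ fun k hk => not_not.1 (Nat.find_min hex hk)

/-- A weakly continuous map from a locally compact regular space to a normed space has norm
oscillation at most `ε` on some nonempty open set. -/
theorem exists_open_small_oscillation {Y E : Type*} [TopologicalSpace Y] [RegularSpace Y]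
    [LocallyCompactSpace Y] [Nonempty Y] [NormedAddCommGroup E] [NormedSpace ℂ E] {f : Y → E}
    (hf : ∀ h : StrongDual ℂ E, Continuous fun y => h (f y)) {ε : ℝ} (hε : 0 < ε) :
    ∃ U : Set Y, IsOpen U ∧ U.Nonempty ∧ ∀ x ∈ U, ∀ y ∈ U, ‖f x - f y‖ ≤ ε := by
  by_contra! hcon
  -- The nodes of a binary tree. By `hcon` the oscillation on every interior exceeds `ε`, so every
  -- node can be split.
  let 𝒟 := {C : Set Y // IsClosed C ∧ (interior C).Nonempty}
  have hsplit : ∀ C : 𝒟, ∃ D : Bool → 𝒟, (∀ b, (D b : Set Y) ⊆ C) ∧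
      ∀ x ∈ (D false : Set Y), ∀ y ∈ (D true : Set Y), ε < ‖f x - f y‖ := by
    intro C
    obtain ⟨D, hD, hD'⟩ := exists_split_of_oscillation hf (hcon _ isOpen_interior C.2.2)
    exact ⟨fun b => ⟨D b, (hD b).1, (hD b).2.1⟩, fun b => (hD b).2.2, hD'⟩
  choose child hsub hsep using hsplit
  obtain ⟨x₀⟩ := ‹Nonempty Y›
  -- A compact root makes the chosen points along every branch cluster.
  obtain ⟨K, hK, hKc, hKcl⟩ := exists_mem_nhds_isCompact_isClosed x₀
  let K₀ : 𝒟 := ⟨K, hKcl, x₀, mem_interior_iff_mem_nhds.2 hK⟩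
  -- The head of the list is the last choice made, in accordance with `binaryPrefix`.
  let T : List Bool → 𝒟 := fun l => l.foldr (fun b C => child C b) K₀
  let p : List Bool → Y := fun l => (T l).2.2.some
  have hp : ∀ l, p l ∈ (T l : Set Y) := fun l => interior_subset (T l).2.2.some_mem
  have hanti : ∀ σ : ℕ → Bool, Antitone fun n => (T (binaryPrefix σ n) : Set Y) :=
    fun σ => antitone_nat_of_succ_le fun n => hsub (T (binaryPrefix σ n)) (σ n)
  have hclus : ∀ σ : ℕ → Bool, ∃ y, MapClusterPt y atTop fun n => p (binaryPrefix σ n) := by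
    intro σ
    obtain ⟨y, -, hy⟩ := hKc.exists_mapClusterPt (f := atTop)
      (u := fun n => p (binaryPrefix σ n))
      (le_principal_iff.2 (Filter.mem_map.2
        (Filter.univ_mem' fun n => hanti σ (Nat.zero_le n) (hp (binaryPrefix σ n)))))
    exact ⟨y, hy⟩
  choose y hy using hclus
  have hyT : ∀ σ n, y σ ∈ (T (binaryPrefix σ n) : Set Y) := fun σ n =>
    (T (binaryPrefix σ n)).2.1.mem_of_mapClusterPt (hy σ)
      ((eventually_ge_atTop n).mono fun k hk => hanti σ hk (hp (binaryPrefix σ k)))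
  have hysep : ∀ σ τ, σ ≠ τ → ε < ‖f (y σ) - f (y τ)‖ := by
    intro σ τ hστ
    obtain ⟨n, hn, hne⟩ := exists_binaryPrefix_split hστ
    have h1 : y σ ∈ (child (T (binaryPrefix σ n)) (σ n) : Set Y) := hyT σ (n + 1)
    have h2 : y τ ∈ (child (T (binaryPrefix τ n)) (τ n) : Set Y) := hyT τ (n + 1)
    rw [← hn] at h2
    cases hs : σ n <;> cases ht : τ n <;> rw [hs] at h1 <;> rw [ht] at h2
    · exact absurd (hs.trans ht.symm) hne
    · exact hsep _ _ h1 _ h2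
    · rw [norm_sub_rev]
      exact hsep _ _ h2 _ h1
    · exact absurd (hs.trans ht.symm) hne
  -- The tree has countably many nodes, so `P` is separable. It contains every `f (y σ)`, although
  -- there are uncountably many of these at mutual distance more than `ε`.
  let P : Submodule ℂ E := (Submodule.span ℂ (Set.range fun l => f (p l))).topologicalClosure
  have hPsep : TopologicalSpace.IsSeparable (P : Set E) := by
    rw [Submodule.topologicalClosure_coe]
    exact ((Set.countable_range _).isSeparable.span (R := ℂ)).closure
  have hyP : ∀ σ, f (y σ) ∈ P := fun σ =>
    (hy σ).apply_mem_of_weakly_continuous hf P (Submodule.isClosed_topologicalClosure _)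
      fun n => Submodule.le_topologicalClosure _ (Submodule.subset_span ⟨_, rfl⟩)
  obtain ⟨c, hc, hPc⟩ := hPsep
  have hd : ∀ σ, ∃ d ∈ c, dist (f (y σ)) d < ε / 2 := fun σ =>
    Metric.mem_closure_iff.1 (hPc (hyP σ)) (ε / 2) (half_pos hε)
  choose d hdc hd using hd
  -- A point of `c` within `ε / 2` of both `f (y σ)` and `f (y τ)` would contradict their
  -- separation. So the Cantor space would be countable, which the diagonal argument refutes.
  have hinj : Function.Injective fun σ => (⟨d σ, hdc σ⟩ : c) := by
    intro σ τ hστ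
    by_contra hne
    have h1 : d σ = d τ := congrArg Subtype.val hστ
    have h2 := hysep σ τ hne
    have h3 := dist_triangle_right (f (y σ)) (f (y τ)) (d σ)
    have h4 := hd σ
    have h5 := hd τ
    rw [← h1] at h5
    rw [← dist_eq_norm] at h2
    linarith
  have := hc.to_subtype
  have hcount : Countable (ℕ → Bool) := hinj.countable
  obtain ⟨e, he⟩ := exists_surjective_nat (ℕ → Bool)
  obtain ⟨n, hn⟩ := he fun k => !e k k
  have := congrFun hn n
  simp at this

/-- A weakly continuous action of a locally compact group by isometries is norm continuous. -/
theorem continuous_orbit_of_weakly_continuous {G E : Type*} [Group G] [TopologicalSpace G]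
    [IsTopologicalGroup G] [LocallyCompactSpace G] [NormedAddCommGroup E] [NormedSpace ℂ E]
    (π : G →* (E →L[ℂ] E)) (hπ : ∀ x ξ, ‖π x ξ‖ ≤ ‖ξ‖) (ξ : E)
    (hw : ∀ h : StrongDual ℂ E, Continuous fun x => h (π x ξ)) : Continuous fun x => π x ξ := by
  have key : ∀ x y z : G, ‖π (z * x) ξ - π (z * y) ξ‖ ≤ ‖π x ξ - π y ξ‖ := by
    intro x y z
    rw [map_mul, map_mul, mul_apply_eq_comp, mul_apply_eq_comp, ← map_sub]
    exact hπ _ _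
  rw [continuous_iff_continuousAt]
  intro x
  rw [ContinuousAt, Metric.tendsto_nhds]
  intro ε hε
  -- `U` lies near some `x₀`, not near `x`. For `y` close to `x` the point `x₀ x⁻¹ y` is in `U`, and
  -- left translation by `x x₀⁻¹` brings the estimate back to `y` and `x`.
  obtain ⟨U, hU, ⟨x₀, hx₀⟩, hosc⟩ := exists_open_small_oscillation hw (half_pos hε)
  have hcont : ContinuousAt (fun y => x₀ * x⁻¹ * y) x := by fun_prop
  have hmem : U ∈ 𝓝 (x₀ * x⁻¹ * x) := by
    rw [inv_mul_cancel_right]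
    exact hU.mem_nhds hx₀
  filter_upwards [hcont hmem] with y hy
  rw [dist_eq_norm]
  have h1 := hosc _ hy _ hx₀
  have h2 := key (x₀ * x⁻¹ * y) x₀ (x * x₀⁻¹)
  have e1 : x * x₀⁻¹ * (x₀ * x⁻¹ * y) = y := by group
  have e2 : x * x₀⁻¹ * x₀ = x := by group
  rw [e1, e2] at h2
  linarith

end WeakContinuity

/-- A bounded functional on a space isometric to a subspace of `V` extends to `V`. -/
theorem LinearIsometryEquiv.exists_extension_to_ambient {A V : Type*} [NormedAddCommGroup A]
    [NormedSpace ℂ A] [NormedAddCommGroup V] [NormedSpace ℂ V] {p : Submodule ℂ V}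
    (ι : A ≃ₗᵢ[ℂ] p) (h : StrongDual ℂ A) : ∃ F : StrongDual ℂ V, ∀ b, F (ι b) = h b := by
  obtain ⟨F, hF, -⟩ :=
    exists_extension_norm_eq p (h.comp ι.symm.toContinuousLinearEquiv.toContinuousLinearMap)
  refine ⟨F, fun b => (hF (ι b)).trans ?_⟩
  exact congrArg h (ι.symm_apply_apply b)

/-! ### The duality `(M_*)* = M`. -/

namespace VonNeumannAlgebra

open scoped InnerProductSpace

section Duality

variable {H : Type*} [NormedAddCommGroup H] [InnerProductSpace ℂ H] [CompleteSpace H]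

theorem norm_vectorFunctional_le (M : VonNeumannAlgebra H) (ξ η : H) :
    ‖M.vectorFunctional ξ η‖ ≤ ‖η‖ * ‖ξ‖ :=
  LinearMap.mkContinuous_norm_le _ (by positivity) _

/-- The duality `(M_*)* = M`: every bounded functional on the dual of `M` agrees on the predual
with the evaluation at an element of `M`. -/
theorem exists_eval_eq (M : VonNeumannAlgebra H)
    (h : StrongDual ℂ (StrongDual ℂ M.toStarSubalgebra)) :
    ∃ m : M.toStarSubalgebra, ∀ φ ∈ M.predual, h φ = φ m := by
  let ω : H → H → StrongDual ℂ M.toStarSubalgebra := M.vectorFunctional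
  have hω : ∀ ξ η (m : M.toStarSubalgebra), ω ξ η m = ⟪η, (m : H →L[ℂ] H) ξ⟫_ℂ :=
    fun _ _ _ => rfl
  -- Values of `h` on vector functionals form a bounded sesquilinear form, hence come from an
  -- operator `t`.
  let B : H →L⋆[ℂ] H →L[ℂ] ℂ := LinearMap.mkContinuous₂
    (LinearMap.mk₂'ₛₗ (starRingEnd ℂ) (RingHom.id ℂ) (fun η ξ => h (ω ξ η))
      (fun η η' ξ => by
        rw [← map_add]
        refine congrArg h (ContinuousLinearMap.ext fun m => ?_)
        simp only [add_apply, hω, inner_add_left])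
      (fun c η ξ => by
        rw [← map_smul]
        refine congrArg h (ContinuousLinearMap.ext fun m => ?_)
        simp only [smul_apply, smul_eq_mul, hω, inner_smul_left])
      (fun η ξ ξ' => by
        rw [← map_add]
        refine congrArg h (ContinuousLinearMap.ext fun m => ?_)
        simp only [add_apply, hω, map_add, inner_add_right])
      (fun c η ξ => by
        rw [RingHom.id_apply, ← map_smul]
        refine congrArg h (ContinuousLinearMap.ext fun m => ?_)
        simp only [smul_apply, smul_eq_mul, hω, map_smul, inner_smul_right]))
    ‖h‖ (fun η ξ => by
      refine (h.le_opNorm _).trans ?_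
      rw [mul_assoc]
      gcongr
      exact M.norm_vectorFunctional_le ξ η)
  let s : H →L[ℂ] H := InnerProductSpace.continuousLinearMapOfBilin B
  have hs : ∀ ξ η, ⟪s η, ξ⟫_ℂ = h (ω ξ η) := fun ξ η =>
    InnerProductSpace.continuousLinearMapOfBilin_apply B η ξ
  let t : H →L[ℂ] H := ContinuousLinearMap.adjoint s
  have ht : ∀ ξ η, ⟪η, t ξ⟫_ℂ = h (ω ξ η) := fun ξ η => by
    rw [ContinuousLinearMap.adjoint_inner_right, hs]
  -- Double commutant: for `c` in `M'`, the pairs `(ξ, c* η)` and `(c ξ, η)` define the same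
  -- functional on `M`, so `t` commutes with `c`.
  have htM : t ∈ M := by
    rw [← SetLike.mem_coe, ← M.centralizer_centralizer, Set.mem_centralizer_iff]
    intro c hc
    ext ξ
    refine ext_inner_left ℂ fun η => ?_
    have e1 : ⟪η, (c * t) ξ⟫_ℂ = ⟪ContinuousLinearMap.adjoint c η, t ξ⟫_ℂ := by
      rw [ContinuousLinearMap.adjoint_inner_left]
      rfl
    have e2 : ⟪η, (t * c) ξ⟫_ℂ = ⟪η, t (c ξ)⟫_ℂ := rfl
    rw [e1, e2, ht, ht]
    refine congrArg h (ContinuousLinearMap.ext fun m => ?_)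
    rw [hω, hω, ContinuousLinearMap.adjoint_inner_left]
    have := (Set.mem_centralizer_iff.1 hc) m m.2
    exact congrArg (fun T : H →L[ℂ] H => ⟪η, T ξ⟫_ℂ) this.symm
  let m : M.toStarSubalgebra := ⟨t, htM⟩
  refine ⟨m, ?_⟩
  have hle : M.predual ≤ LinearMap.ker (h - ContinuousLinearMap.apply ℂ ℂ m).toLinearMap := by
    refine Submodule.topologicalClosure_minimal _ (Submodule.span_le.2 ?_)
      (h - ContinuousLinearMap.apply ℂ ℂ m).isClosed_ker
    rintro _ ⟨ξ, η, rfl⟩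
    change h (M.vectorFunctional ξ η) - ⟪η, t ξ⟫_ℂ = 0
    rw [ht, sub_eq_zero]
  exact fun φ hφ => sub_eq_zero.1 (hle hφ)

theorem norm_predualMap_le (M : VonNeumannAlgebra H)
    (σ : M.toStarSubalgebra ≃⋆ₐ[ℂ] M.toStarSubalgebra) (φ : M.predual) :
    ‖M.predualMap σ φ‖ ≤ ‖φ‖ := by
  rw [Submodule.coe_norm, Submodule.coe_norm]
  refine ContinuousLinearMap.opNorm_le_bound _ (norm_nonneg _) fun m => ?_
  refine ((φ : StrongDual ℂ M.toStarSubalgebra).le_opNorm _).trans_eq ?_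
  exact congrArg (‖(φ : StrongDual ℂ M.toStarSubalgebra)‖ * ·) (M.norm_map_eq σ m)

end Duality

/-! ### The maps `β_x` as a weakly continuous contractive action on `A`. -/

section InducedAction

variable {H : Type u} [NormedAddCommGroup H] [InnerProductSpace ℂ H] [CompleteSpace H]
  (M : VonNeumannAlgebra H) {A : Type a} [NonUnitalNormedRing A] [NormedSpace ℂ A]
  {G : Type v} [Group G]

theorem apply_inducedAction (ι : A ≃ₗᵢ[ℂ] M.predual)
    (α : G →* (M.toStarSubalgebra ≃⋆ₐ[ℂ] M.toStarSubalgebra)) (x : G) (b : A) :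
    ι (M.inducedAction ι α x b) = M.predualMap (α x⁻¹) (ι b) :=
  ι.apply_symm_apply _

theorem norm_inducedAction_le (ι : A ≃ₗᵢ[ℂ] M.predual)
    (α : G →* (M.toStarSubalgebra ≃⋆ₐ[ℂ] M.toStarSubalgebra)) (x : G) (b : A) :
    ‖M.inducedAction ι α x b‖ ≤ ‖b‖ := by
  rw [← ι.norm_map b, ← ι.norm_map, apply_inducedAction]
  exact M.norm_predualMap_le _ _

theorem predualMap_apply (σ : M.toStarSubalgebra ≃⋆ₐ[ℂ] M.toStarSubalgebra) (φ : M.predual)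
    (m : M.toStarSubalgebra) : (M.predualMap σ φ : StrongDual ℂ M.toStarSubalgebra) m =
      (φ : StrongDual ℂ M.toStarSubalgebra) (σ m) := rfl

theorem predual_ext {φ ψ : M.predual} (h : ∀ m, (φ : StrongDual ℂ M.toStarSubalgebra) m =
    (ψ : StrongDual ℂ M.toStarSubalgebra) m) : φ = ψ :=
  Subtype.ext (ContinuousLinearMap.ext h)

/-- Preadjoints reverse products; the inverse in `inducedAction` undoes the reversal. -/
theorem predualMap_mul (σ τ : M.toStarSubalgebra ≃⋆ₐ[ℂ] M.toStarSubalgebra) (φ : M.predual) :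
    M.predualMap (σ * τ) φ = M.predualMap τ (M.predualMap σ φ) :=
  Subtype.ext (ContinuousLinearMap.ext fun _ => rfl)

theorem inducedAction_one (ι : A ≃ₗᵢ[ℂ] M.predual)
    (α : G →* (M.toStarSubalgebra ≃⋆ₐ[ℂ] M.toStarSubalgebra)) (b : A) :
    M.inducedAction ι α 1 b = b := by
  refine ι.injective (M.predual_ext fun m => ?_)
  rw [apply_inducedAction, predualMap_apply, inv_one, map_one]
  rfl

theorem inducedAction_mul (ι : A ≃ₗᵢ[ℂ] M.predual)
    (α : G →* (M.toStarSubalgebra ≃⋆ₐ[ℂ] M.toStarSubalgebra)) (x y : G) (b : A) :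
    M.inducedAction ι α (x * y) b = M.inducedAction ι α x (M.inducedAction ι α y b) := by
  have h1 : α (x * y)⁻¹ = α y⁻¹ * α x⁻¹ :=
    (congrArg α (mul_inv_rev x y)).trans (α.map_mul y⁻¹ x⁻¹)
  have h2 : M.predualMap (α (x * y)⁻¹) (ι b) = M.predualMap (α x⁻¹) (M.predualMap (α y⁻¹) (ι b)) :=
    (congrArg (fun σ => M.predualMap σ (ι b)) h1).trans (M.predualMap_mul _ _ _)
  have h3 : M.predualMap (α x⁻¹) (M.predualMap (α y⁻¹) (ι b)) =
      M.predualMap (α x⁻¹) (ι (M.inducedAction ι α y b)) :=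
    congrArg (M.predualMap (α x⁻¹)) (M.apply_inducedAction ι α y b).symm
  exact congrArg ι.symm (h2.trans h3)

theorem inducedAction_add (ι : A ≃ₗᵢ[ℂ] M.predual)
    (α : G →* (M.toStarSubalgebra ≃⋆ₐ[ℂ] M.toStarSubalgebra)) (x : G) (b c : A) :
    M.inducedAction ι α x (b + c) = M.inducedAction ι α x b + M.inducedAction ι α x c := by
  rw [inducedAction, ι.map_add, (M.predualMap _).map_add, ι.symm.map_add]
  rfl

theorem inducedAction_smul (ι : A ≃ₗᵢ[ℂ] M.predual)
    (α : G →* (M.toStarSubalgebra ≃⋆ₐ[ℂ] M.toStarSubalgebra)) (x : G) (c : ℂ) (b : A) :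
    M.inducedAction ι α x (c • b) = c • M.inducedAction ι α x b := by
  have h1 : M.predualMap (α x⁻¹) (c • ι b) = c • M.predualMap (α x⁻¹) (ι b) := rfl
  have h2 : ι (c • b) = c • ι b := ι.map_smul c b
  have h3 : ι (c • M.inducedAction ι α x b) = c • ι (M.inducedAction ι α x b) := ι.map_smul c _
  exact ι.injective (by rw [h3, apply_inducedAction, apply_inducedAction, h2, h1])

/-- The maps `β_x` as bounded operators. -/
noncomputable def inducedActionHom (ι : A ≃ₗᵢ[ℂ] M.predual)
    (α : G →* (M.toStarSubalgebra ≃⋆ₐ[ℂ] M.toStarSubalgebra)) : G →* (A →L[ℂ] A) where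
  toFun x := LinearMap.mkContinuous
    { toFun := M.inducedAction ι α x
      map_add' := fun b c => M.inducedAction_add ι α x b c
      map_smul' := fun c b => M.inducedAction_smul ι α x c b } 1
    fun b => (M.norm_inducedAction_le ι α x b).trans_eq (one_mul _).symm
  map_one' := ContinuousLinearMap.ext (M.inducedAction_one ι α)
  map_mul' x y := ContinuousLinearMap.ext (M.inducedAction_mul ι α x y)

theorem inducedActionHom_apply (ι : A ≃ₗᵢ[ℂ] M.predual)
    (α : G →* (M.toStarSubalgebra ≃⋆ₐ[ℂ] M.toStarSubalgebra)) (x : G) (b : A) :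
    M.inducedActionHom ι α x b = M.inducedAction ι α x b := rfl

variable [TopologicalSpace G] [IsTopologicalGroup G]

/-- By Hahn–Banach and duality, `h` is evaluation at some `m` in `M`, so the map is `x ↦
φ(α_{x⁻¹}(m))` with `φ = ι b`. -/
theorem continuous_apply_inducedActionHom (ι : A ≃ₗᵢ[ℂ] M.predual)
    (α : G →* (M.toStarSubalgebra ≃⋆ₐ[ℂ] M.toStarSubalgebra)) (hα : M.IsWeakStarContinuous α)
    (b : A) (h : StrongDual ℂ A) : Continuous fun x => h (M.inducedActionHom ι α x b) := by
  obtain ⟨F, hF⟩ := ι.exists_extension_to_ambient h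
  obtain ⟨m, hm⟩ := M.exists_eval_eq F
  have : (fun x => h (M.inducedActionHom ι α x b)) =
      fun x => (ι b : StrongDual ℂ M.toStarSubalgebra) (α x⁻¹ m) := by
    funext x
    rw [← hF, hm _ (ι (M.inducedActionHom ι α x b)).2, M.inducedActionHom_apply,
      apply_inducedAction, predualMap_apply]
  rw [this]
  exact (hα m (ι b)).comp continuous_inv

end InducedAction

end VonNeumannAlgebra

/-! ### Invariant means on `A*` versus fixed points in modules. -/

section InvariantMean

open scoped Topology

/-- The functionals on the dual of a Banach space `A` that are weak-star limits of nets in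
`S ⊆ A`. -/
def weakStarLimits {A : Type*} [NormedAddCommGroup A] [NormedSpace ℂ A] (S : Set A) :
    Set (StrongDual ℂ (StrongDual ℂ A)) :=
  {m | (fun h => m h) ∈ closure ((fun (b : A) (h : StrongDual ℂ A) => h b) '' S)}

namespace BanachGAModule

variable {G : Type v} [Group G] {τ : TopologicalSpace G}
  {A : Type a} [NonUnitalNormedRing A] [NormedSpace ℂ A]
  {X : Type w} [NormedAddCommGroup X] [NormedSpace ℂ X]

/-- Forgetting the continuity of the action of `G`. -/
def toDiscrete {β : G → A → A} (E : BanachGAModule τ β X) : BanachGAModule ⊥ β X where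
  __ := E
  continuous_actG _ := continuous_bot

/-- The bounded functional `b ↦ (T_b n)(f)` on `A`. -/
noncomputable def coefficient {β : G → A → A} (E : BanachGAModule τ β X) (n : Bidual X)
    (f : StrongDual ℂ X) : StrongDual ℂ A :=
  LinearMap.mkContinuous
    { toFun := fun b => E.opA b n f
      map_add' := fun b c => by
        change n (f.comp (E.actA (b + c))) = n (f.comp (E.actA b)) + n (f.comp (E.actA c))
        rw [map_add, ContinuousLinearMap.comp_add, map_add]
      map_smul' := fun c b => by
        change n (f.comp (E.actA (c • b))) = c • n (f.comp (E.actA b))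
        rw [map_smul, ContinuousLinearMap.comp_smul, map_smul] }
    (‖n‖ * ‖f‖) fun b => by
      change ‖n (f.comp (E.actA b))‖ ≤ _
      refine (n.le_opNorm _).trans ?_
      rw [mul_assoc]
      gcongr
      refine (f.opNorm_comp_le _).trans ?_
      gcongr
      exact ContinuousLinearMap.opNorm_le_bound _ (norm_nonneg _) (E.norm_actA_le b)

variable {β : G → A → A} (E : BanachGAModule τ β X)

theorem coefficient_apply (n : Bidual X) (f : StrongDual ℂ X) (b : A) :
    E.coefficient n f b = n (f.comp (E.actA b)) := rfl

theorem norm_coefficient_le (n : Bidual X) (f : StrongDual ℂ X) :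
    ‖E.coefficient n f‖ ≤ ‖n‖ * ‖f‖ :=
  LinearMap.mkContinuous_norm_le _ (by positivity) _

/-- The operator `T` on `X**` with `(T n)(f) = m (b ↦ (T_b n)(f))`. -/
noncomputable def averageOp (m : StrongDual ℂ (StrongDual ℂ A)) : Bidual X →L[ℂ] Bidual X :=
  LinearMap.mkContinuous₂
    (LinearMap.mk₂ ℂ (fun n f => m (E.coefficient n f))
      (fun n n' f => by
        rw [← map_add]
        exact congrArg m (ContinuousLinearMap.ext fun b => rfl))
      (fun c n f => by
        rw [← map_smul]
        exact congrArg m (ContinuousLinearMap.ext fun b => rfl))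
      (fun n f f' => by
        rw [← map_add]
        refine congrArg m (ContinuousLinearMap.ext fun b => ?_)
        rw [add_apply, coefficient_apply, coefficient_apply, coefficient_apply,
          ContinuousLinearMap.add_comp, map_add])
      (fun c n f => by
        rw [← map_smul]
        refine congrArg m (ContinuousLinearMap.ext fun b => ?_)
        rw [smul_apply, coefficient_apply, coefficient_apply,
          ContinuousLinearMap.smul_comp, map_smul]))
    ‖m‖ fun n f => by
      rw [mul_assoc]
      exact (m.le_opNorm _).trans (by gcongr; exact E.norm_coefficient_le n f)

/-- For `∑ n_i ⊗ f_i` in the projective tensor product, the coefficients of `(n_i, f_i)` sum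
absolutely in `A*`. Testing `averageOp m` or `T_b` on this tensor is therefore testing `m` or `b` on
one element of `A*`. -/
theorem averageOp_mem_closureOps {S : Set A} {m : StrongDual ℂ (StrongDual ℂ A)}
    (hm : m ∈ weakStarLimits S) : E.averageOp m ∈ E.closureOps S := by
  let I := {u : ℕ → Bidual X × StrongDual ℂ X // Summable fun i => ‖(u i).1‖ * ‖(u i).2‖}
  have hsum : ∀ u : I, Summable fun i => E.coefficient (u.1 i).1 (u.1 i).2 := fun u =>
    Summable.of_norm_bounded u.2 fun i => E.norm_coefficient_le _ _
  -- Defined on arbitrary functions on `A*`, so that continuity is that of coordinate projections.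
  let g : (StrongDual ℂ A → ℂ) → I → ℂ := fun k u => k (∑' i, E.coefficient (u.1 i).1 (u.1 i).2)
  have hg : Continuous g := continuous_pi fun u => continuous_apply _
  let F : (Bidual X →L[ℂ] Bidual X) → I → ℂ := fun T u => ∑' i, T (u.1 i).1 (u.1 i).2
  have hF : F (E.averageOp m) = g fun h => m h := by
    funext u
    exact (m.map_tsum (hsum u)).symm
  have hFS : ∀ b, F (E.opA b) = g fun h => h b := by
    intro b
    funext u
    exact ((ContinuousLinearMap.apply ℂ ℂ b).map_tsum (hsum u)).symm
  change _ ∈ @closure _ (TopologicalSpace.induced F Pi.topologicalSpace) _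
  rw [closure_induced, hF]
  refine map_mem_closure hg hm ?_
  rintro _ ⟨b, hb, rfl⟩
  exact ⟨_, ⟨b, hb, rfl⟩, hFS b⟩

/-- Covariance: since `x b x⁻¹` acts as `β_x(b)`, conjugation by `T_x` composes each coefficient
with `π x`, and `m` absorbs this. -/
theorem opG_comp_averageOp_comp {π : G →* (A →L[ℂ] A)} (hπ : ∀ x b, π x b = β x b)
    {m : StrongDual ℂ (StrongDual ℂ A)} (hm : ∀ x h, m (h.comp (π x)) = m h) (x : G) :
    (E.opG x).comp ((E.averageOp m).comp (E.opG x⁻¹)) = E.averageOp m := by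
  ext n f
  change m (E.coefficient (E.opG x⁻¹ n) (f.comp (E.actG x))) = m (E.coefficient n f)
  rw [← hm x (E.coefficient n f)]
  refine congrArg m (ContinuousLinearMap.ext fun b => ?_)
  change n (((f.comp (E.actG x)).comp (E.actA b)).comp (E.actG x⁻¹)) =
    n (f.comp (E.actA (π x b)))
  refine congrArg n (ContinuousLinearMap.ext fun ξ => congrArg f ?_)
  rw [hπ]
  exact (E.covariant x b ξ).symm

/-- An invariant mean on the dual of `A` yields a fixed point in every module. -/
theorem hasFixedPoint_of_invariant_mean {π : G →* (A →L[ℂ] A)} (hπ : ∀ x b, π x b = β x b)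
    {S : Set A} (h : ∃ m ∈ weakStarLimits S, ∀ x h, m (h.comp (π x)) = m h) :
    E.HasFixedPoint S := by
  obtain ⟨m, hmS, hm⟩ := h
  exact ⟨E.averageOp m, E.averageOp_mem_closureOps hmS, E.opG_comp_averageOp_comp hπ hm⟩

/-- If `p (b e) = b` for an invariant vector `e` and an equivariant map `p : X → A`, then a fixed
point for `X` yields an invariant mean on the dual of `A`. -/
theorem HasFixedPoint.exists_invariant_mean {E : BanachGAModule τ β X} {S : Set A}
    (hE : E.HasFixedPoint S) {π : G →* (A →L[ℂ] A)} (e : X) (he : ∀ x, E.actG x e = e)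
    (p : X →L[ℂ] A) (hp : ∀ x ξ, p (E.actG x ξ) = π x (p ξ)) (hpe : ∀ b, p (E.actA b e) = b) :
    ∃ m ∈ weakStarLimits S, ∀ x h, m (h.comp (π x)) = m h := by
  obtain ⟨T, hT, hfix⟩ := hE
  let n : Bidual X := ContinuousLinearMap.apply ℂ ℂ e
  refine ⟨(T n).comp (ContinuousLinearMap.precomp ℂ p), ?_, fun x h => ?_⟩
  · let I := {u : ℕ → Bidual X × StrongDual ℂ X // Summable fun i => ‖(u i).1‖ * ‖(u i).2‖}
    let F : (Bidual X →L[ℂ] Bidual X) → I → ℂ := fun T u => ∑' i, T (u.1 i).1 (u.1 i).2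
    have hT' : F T ∈ closure (F '' (E.opA '' S)) := by
      change T ∈ @closure _ (TopologicalSpace.induced F Pi.topologicalSpace) _ at hT
      rwa [closure_induced] at hT
    -- The elementary tensor `n ⊗ (h ∘ p)` as a sequence with one nonzero term: weak-star
    -- approximation of `T` then gives approximation of `T n (h ∘ p)` by `h (p (b e)) = h b`.
    let t : StrongDual ℂ A → ℕ → Bidual X × StrongDual ℂ X := fun h i =>
      if i = 0 then (n, h.comp p) else 0
    have ht : ∀ h i, i ≠ 0 → t h i = 0 := fun h i hi => if_neg hi
    let s : StrongDual ℂ A → I := fun h => ⟨t h, summable_of_ne_finset_zero (s := {0})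
      fun i hi => by simp [ht h i (by simpa using hi)]⟩
    have hs : ∀ T h, F T (s h) = T n (h.comp p) := by
      intro T h
      refine (tsum_eq_single 0 fun i hi => ?_).trans rfl
      change T (t h i).1 (t h i).2 = 0
      simp [ht h i hi]
    have hcont : Continuous fun (k : I → ℂ) (h : StrongDual ℂ A) => k (s h) :=
      continuous_pi fun h => continuous_apply _
    have := map_mem_closure hcont hT'
      (t := (fun (b : A) (h : StrongDual ℂ A) => h b) '' S) (by
        rintro _ ⟨_, ⟨b, hb, rfl⟩, rfl⟩
        refine ⟨b, hb, funext fun h => ?_⟩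
        change h b = F (E.opA b) (s h)
        rw [hs]
        exact (congrArg h (hpe b)).symm)
    simp only [hs] at this
    exact this
  -- As `e` is fixed by `G`, the right factor of the conjugation disappears at `n`; equivariance of
  -- `p` turns the left one into `π x`.
  · have hn : E.opG x⁻¹ n = n :=
      ContinuousLinearMap.ext fun f => congrArg f (he x⁻¹)
    have h1 := congrArg (fun T : Bidual X →L[ℂ] Bidual X => T n (h.comp p)) (hfix x)
    have h2 : E.opG x (T (E.opG x⁻¹ n)) (h.comp p) = T n (h.comp p) := h1
    rw [hn] at h2
    refine Eq.trans ?_ h2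
    change T n ((h.comp (π x)).comp p) = T n ((h.comp p).comp (E.actG x))
    exact congrArg (T n) (ContinuousLinearMap.ext fun ξ => congrArg h (hp x ξ).symm)

end BanachGAModule

end InvariantMean

/-! ### The unitization of `A` as a module with an invariant cyclic vector. -/

section UnitizationModule

set_option linter.unusedSectionVars false

variable {G : Type v} [Group G] {A : Type a} [NonUnitalNormedRing A] [NormedSpace ℂ A]

/-- The Banach space `A ⊕ ℂ` with the sum norm. -/
abbrev SumUnitization (A : Type a) : Type max a w := WithLp 1 (A × ULift.{w} ℂ)

namespace SumUnitization

theorem norm_eq (ξ : SumUnitization.{a, w} A) : ‖ξ‖ = ‖ξ.fst‖ + ‖ξ.snd.down‖ :=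
  WithLp.prod_norm_eq_of_L1 ξ

theorem continuous_toLp {Y : Type*} [TopologicalSpace Y] {f : Y → A} (hf : Continuous f)
    (c : ULift.{w} ℂ) :
    Continuous fun y => (WithLp.toLp 1 (f y, c) : SumUnitization.{a, w} A) :=
  (WithLp.prod_continuous_toLp 1 A (ULift.{w} ℂ)).comp (hf.prodMk continuous_const)

/-- The projection of `A ⊕ ℂ` onto `A`. -/
noncomputable def proj : SumUnitization.{a, w} A →L[ℂ] A :=
  LinearMap.mkContinuous
    { toFun := fun ξ => ξ.fst
      map_add' := fun _ _ => rfl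
      map_smul' := fun _ _ => rfl } 1
    fun ξ => by
      rw [one_mul, norm_eq]
      exact le_add_of_nonneg_right (norm_nonneg _)

theorem ext {ξ η : SumUnitization.{a, w} A} (h1 : ξ.fst = η.fst) (h2 : ξ.snd = η.snd) : ξ = η :=
  WithLp.ofLp_injective 1 (Prod.ext h1 h2)

/-- The operator `(b, c) ↦ (S b, c)`. -/
noncomputable def lift (S : A →L[ℂ] A) (hS : ∀ b, ‖S b‖ ≤ ‖b‖) :
    SumUnitization.{a, w} A →L[ℂ] SumUnitization.{a, w} A :=
  LinearMap.mkContinuous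
    { toFun := fun ξ => WithLp.toLp 1 (S ξ.fst, ξ.snd)
      map_add' := fun ξ η => ext (map_add S ξ.fst η.fst) rfl
      map_smul' := fun c ξ => ext (map_smul S c ξ.fst) rfl } 1
    fun ξ => by
      rw [one_mul, norm_eq, norm_eq]
      exact add_le_add (hS _) le_rfl

variable [IsScalarTower ℂ A A] [SMulCommClass ℂ A A]

/-- The operator of left multiplication by `b` on the unitization of `A`. -/
noncomputable def mulLeft (b : A) : SumUnitization.{a, w} A →L[ℂ] SumUnitization.{a, w} A :=
  LinearMap.mkContinuous
    { toFun := fun ξ => WithLp.toLp 1 (b * ξ.fst + ξ.snd.down • b, 0)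
      map_add' := fun ξ η => by
        refine ext ?_ (add_zero 0).symm
        change b * (ξ.fst + η.fst) + (ξ.snd.down + η.snd.down) • b =
          b * ξ.fst + ξ.snd.down • b + (b * η.fst + η.snd.down • b)
        rw [mul_add, add_smul]
        abel
      map_smul' := fun c ξ => by
        refine ext ?_ (smul_zero c).symm
        change b * (c • ξ.fst) + (c * ξ.snd.down) • b = c • (b * ξ.fst + ξ.snd.down • b)
        rw [mul_smul_comm, mul_smul, smul_add] }
    -- The sum norm is what gives the constant `‖b‖`: both `b * a` and `c • b` contribute to the
    -- `A`-component.
    ‖b‖ fun ξ => by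
      rw [norm_eq ξ, norm_eq]
      change ‖b * ξ.fst + ξ.snd.down • b‖ + ‖(0 : ℂ)‖ ≤ _
      rw [norm_zero, add_zero, mul_add]
      refine (norm_add_le _ _).trans (add_le_add (norm_mul_le _ _) ?_)
      rw [norm_smul, mul_comm]

theorem norm_mulLeft_le (b : A) (ξ : SumUnitization.{a, w} A) : ‖mulLeft b ξ‖ ≤ ‖b‖ * ‖ξ‖ :=
  (mulLeft b).le_of_opNorm_le (LinearMap.mkContinuous_norm_le _ (norm_nonneg _) _) ξ

/-- The left multiplication of `A` on its unitization. -/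
noncomputable def mulLeftHom :
    A →ₙₐ[ℂ] (SumUnitization.{a, w} A →L[ℂ] SumUnitization.{a, w} A) where
  toFun := mulLeft
  map_smul' c b := by
    refine ContinuousLinearMap.ext fun ξ => ext ?_ (smul_zero c).symm
    change (c • b) * ξ.fst + ξ.snd.down • c • b = c • (b * ξ.fst + ξ.snd.down • b)
    rw [smul_mul_assoc, smul_comm, smul_add]
  map_zero' := by
    refine ContinuousLinearMap.ext fun ξ => ext ?_ rfl
    change 0 * ξ.fst + ξ.snd.down • (0 : A) = 0
    rw [zero_mul, smul_zero, add_zero]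
  map_add' b c := by
    refine ContinuousLinearMap.ext fun ξ => ext ?_ (add_zero 0).symm
    change (b + c) * ξ.fst + ξ.snd.down • (b + c) =
      b * ξ.fst + ξ.snd.down • b + (c * ξ.fst + ξ.snd.down • c)
    rw [add_mul, smul_add]
    abel
  map_mul' b c := by
    refine ContinuousLinearMap.ext fun ξ => ext ?_ rfl
    change b * c * ξ.fst + ξ.snd.down • (b * c) =
      b * (c * ξ.fst + ξ.snd.down • c) + (0 : ℂ) • b
    rw [mul_add, zero_smul, add_zero, mul_smul_comm, mul_assoc]

/-- The unitization of `A` as a Banach `G-A`-module. -/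
noncomputable def module {τ : TopologicalSpace G} {β : G → A → A} (π : G →* (A →L[ℂ] A))
    (hπβ : ∀ x b, π x b = β x b) (hπ : ∀ x b, ‖π x b‖ ≤ ‖b‖)
    (hπc : ∀ b, Continuous fun x => π x b)
    (hβ : ∀ x b c, β x (b * c) = β x b * β x c) :
    BanachGAModule τ β (SumUnitization.{a, w} A) where
  actG :=
    { toFun := fun x => lift (π x) (hπ x)
      map_one' := ContinuousLinearMap.ext fun ξ => ext
        (congrArg (fun S : A →L[ℂ] A => S ξ.fst) π.map_one) rfl
      map_mul' := fun x y => ContinuousLinearMap.ext fun ξ => ext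
        (congrArg (fun S : A →L[ℂ] A => S ξ.fst) (π.map_mul x y)) rfl }
  norm_actG_le x ξ := by
    rw [norm_eq, norm_eq]
    exact add_le_add (hπ x _) le_rfl
  continuous_actG ξ := continuous_toLp (hπc ξ.fst) ξ.snd
  actA := mulLeftHom
  norm_actA_le := norm_mulLeft_le
  covariant x b ξ := by
    refine ext ?_ rfl
    change β x b * ξ.fst + ξ.snd.down • β x b = π x (b * π x⁻¹ ξ.fst + ξ.snd.down • b)
    -- Multiplicativity of `β_x` splits `β_x (b * β_{x⁻¹} a)`, and the inner factor cancels to `a`.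
    have h1 : π x (π x⁻¹ ξ.fst) = ξ.fst := by
      have := congrArg (fun S : A →L[ℂ] A => S ξ.fst) (π.map_mul x x⁻¹)
      rw [mul_inv_cancel, π.map_one] at this
      exact this.symm
    rw [map_add, map_smul, hπβ x (b * _), hβ, ← hπβ x (π x⁻¹ _), h1, hπβ]

end SumUnitization

/-- The fixed point property for the unitization yields an invariant mean. -/
theorem exists_invariant_mean_of_unitization [IsScalarTower ℂ A A] [SMulCommClass ℂ A A]
    {τ : TopologicalSpace G} {β : G → A → A} (π : G →* (A →L[ℂ] A))
    (hπβ : ∀ x b, π x b = β x b) (hπ : ∀ x b, ‖π x b‖ ≤ ‖b‖)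
    (hπc : ∀ b, Continuous fun x => π x b)
    (hβ : ∀ x b c, β x (b * c) = β x b * β x c) {S : Set A}
    (h : (SumUnitization.module.{v, a, w} π hπβ hπ hπc hβ).HasFixedPoint S) :
    ∃ m ∈ weakStarLimits S, ∀ x h, m (h.comp (π x)) = m h := by
  -- The vector is the adjoined unit `(0, 1)`: `G` fixes it and `b (0, 1) = (b, 0)`.
  refine h.exists_invariant_mean (WithLp.toLp 1 (0, ⟨1⟩)) (fun x => ?_) SumUnitization.proj
    (fun x ξ => rfl) fun b => ?_
  · exact SumUnitization.ext (map_zero (π x)) rfl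
  · change b * 0 + (1 : ℂ) • b = b
    rw [mul_zero, zero_add, one_smul]

end UnitizationModule

/-! ### The equivalence. -/

theorem corollary4p5 {G : Type v} [Group G] [τ : TopologicalSpace G] [IsTopologicalGroup G]
    [LocallyCompactSpace G] {H : Type u} [NormedAddCommGroup H] [InnerProductSpace ℂ H]
    [CompleteSpace H] (M : VonNeumannAlgebra H)
    {A : Type a} [NonUnitalNormedRing A] [NormedSpace ℂ A] [IsScalarTower ℂ A A]
    [SMulCommClass ℂ A A] (ι : A ≃ₗᵢ[ℂ] M.predual)
    (α : G →* (M.toStarSubalgebra ≃⋆ₐ[ℂ] M.toStarSubalgebra)) (hα : M.IsWeakStarContinuous α)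
    (hβ : ∀ (x : G) (b c : A), M.inducedAction ι α x (b * c) =
      M.inducedAction ι α x b * M.inducedAction ι α x c) :
    VonNeumannAlgebra.HasFixedPointProperty.{u, v, a, w} M ι α τ ↔
      VonNeumannAlgebra.HasFixedPointProperty.{u, v, a, w} M ι α ⊥ := by
  constructor
  · intro hτ X _ _ _ E
    -- Modules must be complete, so `A` needs the completeness of the closed subspace `M_*`.
    have : CompleteSpace M.predual :=
      (Submodule.isClosed_topologicalClosure _).completeSpace_coe
    have : CompleteSpace A := (completeSpace_congr (e := ι.toEquiv) ι.isometry.isUniformEmbedding).2 this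
    refine E.hasFixedPoint_of_invariant_mean (M.inducedActionHom_apply ι α) ?_
    exact exists_invariant_mean_of_unitization (M.inducedActionHom ι α)
      (M.inducedActionHom_apply ι α) (M.norm_inducedAction_le ι α)
      (fun b => continuous_orbit_of_weakly_continuous (M.inducedActionHom ι α)
        (M.norm_inducedAction_le ι α) b (M.continuous_apply_inducedActionHom ι α hα b))
      -- The lifted copy of `ℂ` puts the unitization in `Type (max a w)`, the universe over which
      -- modules range.
      hβ (hτ (SumUnitization.{a, w} A) _)
  · intro hd X _ _ _ E
    -- Forgetting continuity changes neither `P_X` nor the operators `T_x`.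
    exact hd X E.toDiscrete
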